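/- Let $n\ge 0$ and let $X_1,\dots,X_n$ be independent symmetric real random variables with $\mathbf{E}X_i^2=1$ and with logarithmically concave tails, i.e. for each $i$ the function $t\mapsto \ln \mathbf{P}(|X_i|\ge t)$ is concave from $[0,\infty)$ to $[-\infty,0]$. Write $\|Y\|_p=(\mathbf{E}|Y|^p)^{1/p}$ for a random variable $Y$, and let $\gamma_p=\|G\|_p$, where $G$ is a standard Gaussian $\mathcal{N}(0,1)$ random variable. Then for all real numbers $a_1,\dots,a_n$ and every real $p\ge 3$, the moment $\mathbf{E}\big|\sum_{i=1}^n a_iX_i\big|^p$ is finite and \[ \Big|\,\Big\|\sum_{i=1}^n a_iX_i\Big\|_p-\gamma_p\|a\|_2\Big|\le p\,\|a\|_\infty , \] where $\|a\|_2=\big(\sum_{i=1}^n a_i^2\big)^{1/2}$ and $\|a\|_\infty=\max_{1\le i\le n}|a_i|$ (equal to $0$ if $n=0$). -/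

import Mathlib

open MeasureTheory ProbabilityTheory

/-- `X` has logarithmically concave tails: `t ↦ ln P(|X| ≥ t)` is a concave function from
`[0, ∞)` to `[-∞, 0]`. The logarithm takes values in the extended reals, with `ln 0 = -∞`
(and `0 * (-∞) = 0`). -/
def HasLogConcaveTails {Ω : Type*} [MeasurableSpace Ω] (X : Ω → ℝ) (P : Measure Ω) : Prop :=
  ∀ s t a b : ℝ, 0 ≤ s → 0 ≤ t → 0 ≤ a → 0 ≤ b → a + b = 1 →
    (a : EReal) * ENNReal.log (P {ω | s ≤ |X ω|}) + (b : EReal) * ENNReal.log (P {ω | t ≤ |X ω|})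
      ≤ ENNReal.log (P {ω | a * s + b * t ≤ |X ω|})

/-- `X` is symmetric: `X` and `-X` have the same distribution. -/
def IsSymmetricRV {Ω : Type*} [MeasurableSpace Ω] (X : Ω → ℝ) (P : Measure Ω) : Prop :=
  IdentDistrib X (fun ω => -X ω) P P

/-- `γ_p`, the `p`-th norm `(E |G|^p)^(1/p)` of a standard Gaussian random variable `G`. -/
noncomputable def gaussianNorm (p : ℝ) : ℝ :=
  lpNorm (fun x : ℝ => x) (ENNReal.ofReal p) (gaussianReal 0 1)

/-! Put Yᵢ = aᵢXᵢ, vᵢ = aᵢ², M = max vᵢ, σ² = ∑ vᵢ and m_p = E|G|^p. The sum S is compared with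
Gaussians of variance slightly above and slightly below σ²: with k = ⌊(p-2)/2⌋, m_p (σ² -
(4+k)M)₊^(p/2) ≤ E|S|^p ≤ m_p (σ² + (1+k)M)^(p/2). Taking p-th roots and using √(x+y) ≤ √x + √y, the
error is at most γ_p √(4+k) √M, and γ_p² ≤ p - 1 makes this at most p√M.

Log-concavity enters only through P(|Y| ≥ s+t) ≤ P(|Y| ≥ s) P(|Y| ≥ t), which gives E(|Y|-u)₊² ≤ v
P(|Y| ≥ u). Inserted in a Taylor formula with integral remainder for |z+u|^p + |z-u|^p, this yields
for p ≥ 4 |z|^p + p(p-1)/2 · v |z|^(p-2) ≤ E|z+Y|^p ≤ |z|^p + p(p-1)/2 · v E|z+Y|^(p-2)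
(`le_lintegral_abs_add_rpow`, `lintegral_abs_add_rpow_le`). Since m_p = (p-1) m_{p-2}, the Gaussian
bounds propagate from order p-2 to order p by adding the summands one at a time. Each such passage
costs one more M.

The base range is 2 ≤ p < 4. Order 2 is the variance. For 2 < p < 4, |x|^p is a positive multiple of
∫₀^∞ (cos(tx) - 1 + t²x²/2) t^(-p-1) dt, so it suffices to compare characteristic functions; these
factor over independent summands, and E Y⁴ ≤ 6v² controls each factor. -/

/-! ### Taylor's formula and domination by a second derivative. -/

/-- Third order Taylor formula at `0` for a function with vanishing derivative at `0`. -/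
lemma taylor_three_of_deriv_eq_zero {g g₁ g₂ g₃ : ℝ → ℝ} (h₁ : ∀ x, HasDerivAt g (g₁ x) x)
    (h₂ : ∀ x, HasDerivAt g₁ (g₂ x) x) (h₃ : ∀ x, HasDerivAt g₂ (g₃ x) x)
    (hc : Continuous g₃) (h0 : g₁ 0 = 0) (x : ℝ) :
    g x = g 0 + x ^ 2 / 2 * g₂ 0 + ∫ u in (0 : ℝ)..x, (x - u) ^ 2 / 2 * g₃ u := by
  have hd : ∀ u, HasDerivAt (fun u => g u + (x - u) * g₁ u + (x - u) ^ 2 / 2 * g₂ u)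
      ((x - u) ^ 2 / 2 * g₃ u) u := by
    intro u
    have hx : HasDerivAt (fun u => x - u) (-1) u := by
      simpa using (hasDerivAt_id u).const_sub x
    refine (((h₁ u).add (hx.mul (h₂ u))).add (((hx.pow 2).div_const 2).mul (h₃ u))).congr_deriv ?_
    simp; ring
  have := intervalIntegral.integral_eq_sub_of_hasDerivAt (a := 0) (b := x) (fun u _ => hd u)
    ((by fun_prop : Continuous fun u => (x - u) ^ 2 / 2 * g₃ u).intervalIntegrable 0 x)
  rw [this, h0]
  ring

lemma ofReal_intervalIntegral_eq_lintegral {h : ℝ → ℝ} (hc : Continuous h) {x : ℝ} (hx : 0 ≤ x)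
    (hnn : ∀ u, 0 ≤ u → 0 ≤ h u) :
    ENNReal.ofReal (∫ u in (0 : ℝ)..x, h u) = ∫⁻ u in Set.Ioc 0 x, ENNReal.ofReal (h u) := by
  rw [intervalIntegral.integral_of_le hx, ofReal_integral_eq_lintegral_ofReal]
  · exact (hc.integrableOn_Icc (a := 0) (b := x)).mono_set Set.Ioc_subset_Icc_self
  · exact (ae_restrict_mem measurableSet_Ioc).mono fun u hu => hnn u hu.1.le

/-- If `E (T - u)₊² ≤ v P(T ≥ u)`, then `E g(T) ≤ g(0) + v / 2 * E g''(T)` whenever `g'(0) = 0`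
and `g''' ≥ 0` on `[0, ∞)`. -/
lemma lintegral_le_add_lintegral_second_deriv {Ω : Type*} [MeasurableSpace Ω] {P : Measure Ω}
    [IsProbabilityMeasure P] {T : Ω → ℝ} (hT : Measurable T) (hT0 : ∀ ω, 0 ≤ T ω) {v : ℝ}
    (hv : 0 ≤ v)
    (htail : ∀ u, 0 ≤ u → ∫⁻ ω, ENNReal.ofReal (max (T ω - u) 0 ^ 2) ∂P
      ≤ ENNReal.ofReal v * P {ω | u ≤ T ω})
    {g g₁ g₂ g₃ : ℝ → ℝ} (h₁ : ∀ x, HasDerivAt g (g₁ x) x)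
    (h₂ : ∀ x, HasDerivAt g₁ (g₂ x) x) (h₃ : ∀ x, HasDerivAt g₂ (g₃ x) x)
    (hc : Continuous g₃) (h0 : g₁ 0 = 0) (hg : 0 ≤ g 0) (hg₂ : 0 ≤ g₂ 0)
    (hg₃ : ∀ u, 0 ≤ u → 0 ≤ g₃ u) :
    ∫⁻ ω, ENNReal.ofReal (g (T ω)) ∂P
      ≤ ENNReal.ofReal (g 0) + ENNReal.ofReal (v / 2) * ∫⁻ ω, ENNReal.ofReal (g₂ (T ω)) ∂P := by
  set μ : Measure ℝ := volume.restrict (Set.Ioi 0)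
  have hpt : ∀ ω, ENNReal.ofReal (g (T ω)) = ENNReal.ofReal (g 0)
      + ENNReal.ofReal (g₂ 0 / 2) * ENNReal.ofReal (max (T ω - 0) 0 ^ 2)
      + ∫⁻ u, ENNReal.ofReal (g₃ u / 2) * ENNReal.ofReal (max (T ω - u) 0 ^ 2) ∂μ := by
    intro ω
    have hI : 0 ≤ ∫ u in (0 : ℝ)..T ω, (T ω - u) ^ 2 / 2 * g₃ u :=
      intervalIntegral.integral_nonneg (hT0 ω) fun u hu =>
        mul_nonneg (by positivity) (hg₃ u hu.1)
    rw [taylor_three_of_deriv_eq_zero h₁ h₂ h₃ hc h0 (T ω), ENNReal.ofReal_add (by positivity) hI,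
      ENNReal.ofReal_add hg (by positivity), ofReal_intervalIntegral_eq_lintegral (by fun_prop)
        (hT0 ω) (fun u hu => mul_nonneg (by positivity) (hg₃ u hu))]
    refine congrArg₂ _ (congrArg₂ _ rfl ?_) ?_
    · rw [← ENNReal.ofReal_mul (by positivity), sub_zero, max_eq_left (hT0 ω)]
      congr 1; ring
    · rw [← lintegral_indicator measurableSet_Ioc, ← lintegral_indicator measurableSet_Ioi]
      congr 1
      ext u
      by_cases hu : 0 < u
      · rw [Set.indicator_of_mem (s := Set.Ioi 0) hu,
          ← ENNReal.ofReal_mul (by have := hg₃ u hu.le; positivity)]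
        by_cases hu' : u ≤ T ω
        · rw [Set.indicator_of_mem (s := Set.Ioc 0 (T ω)) ⟨hu, hu'⟩, max_eq_left (by linarith)]
          congr 1; ring
        · rw [Set.indicator_of_notMem (fun h => hu' h.2), max_eq_right (by linarith)]
          simp
      · rw [Set.indicator_of_notMem (fun h => hu h.1), Set.indicator_of_notMem (s := Set.Ioi 0) hu]
  have hpt₂ : ∀ ω, ENNReal.ofReal (g₂ (T ω)) = ENNReal.ofReal (g₂ 0)
      + ∫⁻ u, ENNReal.ofReal (g₃ u) * {ω | u ≤ T ω}.indicator 1 ω ∂μ := by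
    intro ω
    have hft := intervalIntegral.integral_eq_sub_of_hasDerivAt (a := 0) (b := T ω)
      (fun u _ => h₃ u) (hc.intervalIntegrable 0 (T ω))
    have hI : 0 ≤ ∫ u in (0 : ℝ)..T ω, g₃ u :=
      intervalIntegral.integral_nonneg (hT0 ω) fun u hu => hg₃ u hu.1
    rw [show g₂ (T ω) = g₂ 0 + ∫ u in (0 : ℝ)..T ω, g₃ u by rw [hft]; ring,
      ENNReal.ofReal_add hg₂ hI, ofReal_intervalIntegral_eq_lintegral hc (hT0 ω) hg₃]
    congr 1
    rw [← lintegral_indicator measurableSet_Ioc, ← lintegral_indicator measurableSet_Ioi]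
    congr 1
    ext u
    by_cases hu : 0 < u <;> by_cases hu' : u ≤ T ω <;> simp [Set.indicator, hu, hu']
  have hm : Measurable (Function.uncurry fun (ω : Ω) (u : ℝ) =>
      ENNReal.ofReal (g₃ u / 2) * ENNReal.ofReal (max (T ω - u) 0 ^ 2)) := by
    have := hc.measurable
    unfold Function.uncurry
    fun_prop
  have hm₂ : Measurable (Function.uncurry fun (ω : Ω) (u : ℝ) =>
      ENNReal.ofReal (g₃ u) * {ω | u ≤ T ω}.indicator (1 : Ω → ENNReal) ω) := by
    have h3 := hc.measurable
    have : Measurable fun x : Ω × ℝ => {x : Ω × ℝ | x.2 ≤ T x.1}.indicator (1 : Ω × ℝ → ENNReal) x :=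
      measurable_one.indicator (measurableSet_le measurable_snd (hT.comp measurable_fst))
    exact (h3.ennreal_ofReal.comp measurable_snd).mul this
  have hset : ∀ u, MeasurableSet {ω | u ≤ T ω} := fun u => measurableSet_le measurable_const hT
  have hhalf : ENNReal.ofReal (v / 2) * 2 = ENNReal.ofReal v := by
    rw [show (2 : ENNReal) = ENNReal.ofReal 2 by simp, ← ENNReal.ofReal_mul (by positivity)]
    congr 1; ring
  simp_rw [hpt, hpt₂]
  rw [lintegral_add_right _ (by exact hm.lintegral_prod_right'),
    lintegral_add_left measurable_const, lintegral_const_mul _ (by fun_prop),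
    lintegral_lintegral_swap hm.aemeasurable, lintegral_add_left measurable_const,
    lintegral_lintegral_swap hm₂.aemeasurable, mul_add, lintegral_const, lintegral_const]
  simp only [measure_univ, mul_one]
  rw [add_assoc]
  -- After Tonelli the two sides match term by term: the tail hypothesis at 0 handles the quadratic
  -- term, and at each u > 0 it handles the integrand weighted by g'''(u).
  refine add_le_add le_rfl (add_le_add ?_ ?_)
  · refine (mul_le_mul_right (htail 0 le_rfl) _).trans ?_
    simp only [hT0, Set.ofPred_true, measure_univ, mul_one]
    rw [← ENNReal.ofReal_mul (by positivity), ← ENNReal.ofReal_mul (by positivity)]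
    exact le_of_eq (by congr 1; ring)
  · rw [← lintegral_const_mul' _ _ ENNReal.ofReal_ne_top]
    refine lintegral_mono_ae ((ae_restrict_mem measurableSet_Ioi).mono fun u hu => ?_)
    have hu0 : 0 ≤ u := le_of_lt hu
    rw [lintegral_const_mul _ (by fun_prop),
      lintegral_const_mul _ (measurable_one.indicator (hset u)), lintegral_indicator_one (hset u)]
    refine (mul_le_mul_right (htail u hu0) _).trans (le_of_eq ?_)
    rw [← mul_assoc, ← mul_assoc, ← ENNReal.ofReal_mul (by have := hg₃ u hu0; positivity),
      ← ENNReal.ofReal_mul (by positivity)]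
    congr 2; ring

/-! ### Symmetrized powers |z+u|^p + |z-u|^p. -/

lemma hasDerivAt_abs_rpow_mul_self {q : ℝ} (hq : 1 < q) (x : ℝ) :
    HasDerivAt (fun x : ℝ => |x| ^ q * x) ((q + 1) * |x| ^ q) x := by
  refine ((hasDerivAt_abs_rpow x hq).mul (hasDerivAt_id x)).congr_deriv ?_
  rcases eq_or_ne x 0 with rfl | hx
  · simp [Real.zero_rpow (by linarith : q ≠ 0)]
  · have h : |x| ^ q = |x| ^ (q - 2) * x ^ 2 := by
      rw [← sq_abs, ← Real.rpow_natCast, ← Real.rpow_add (abs_pos.2 hx)]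
      congr 1; norm_num
    simp only [id, h]
    ring

lemma monotone_abs_rpow_mul_self {q : ℝ} (hq : 0 ≤ q) : Monotone fun x : ℝ => |x| ^ q * x := by
  intro x y hxy
  dsimp only
  rcases le_total 0 x with hx | hx
  · rw [abs_of_nonneg hx, abs_of_nonneg (hx.trans hxy)]
    have := hx.trans hxy
    gcongr
  · rcases le_total 0 y with hy | hy
    · exact (mul_nonpos_of_nonneg_of_nonpos (by positivity) hx).trans (by positivity)
    · rw [abs_of_nonpos hx, abs_of_nonpos hy]
      have hy' : 0 ≤ -y := by linarith
      have hx' : 0 ≤ -x := by linarith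
      have : (-y) ^ q * (-y) ≤ (-x) ^ q * (-x) := by gcongr
      linarith

/-- The derivatives of `u ↦ |z + u| ^ p + |z - u| ^ p` up to order three. -/
lemma hasDerivAt_abs_rpow_symmetrized {p : ℝ} (hp : 4 ≤ p) (z : ℝ) :
    (∀ u, HasDerivAt (fun u => |z + u| ^ p + |z - u| ^ p)
      (p * (|z + u| ^ (p - 2) * (z + u)) - p * (|z - u| ^ (p - 2) * (z - u))) u) ∧
    (∀ u, HasDerivAt
      (fun u => p * (|z + u| ^ (p - 2) * (z + u)) - p * (|z - u| ^ (p - 2) * (z - u)))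
      (p * (p - 1) * (|z + u| ^ (p - 2) + |z - u| ^ (p - 2))) u) ∧
    (∀ u, HasDerivAt (fun u => p * (p - 1) * (|z + u| ^ (p - 2) + |z - u| ^ (p - 2)))
      (p * (p - 1) * (p - 2) * (|z + u| ^ (p - 4) * (z + u) - |z - u| ^ (p - 4) * (z - u))) u) := by
  have ha : ∀ u, HasDerivAt (fun u => z + u) 1 u := fun u => (hasDerivAt_id u).const_add z
  have hs : ∀ u, HasDerivAt (fun u => z - u) (-1) u := fun u => (hasDerivAt_id u).const_sub z
  refine ⟨fun u => ?_, fun u => ?_, fun u => ?_⟩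
  · refine (((hasDerivAt_abs_rpow (z + u) (by linarith : 1 < p)).comp u (ha u)).add
      ((hasDerivAt_abs_rpow (z - u) (by linarith : 1 < p)).comp u (hs u))).congr_deriv ?_
    ring
  · refine ((((hasDerivAt_abs_rpow_mul_self (by linarith : 1 < p - 2) (z + u)).comp u
      (ha u)).const_mul p).sub (((hasDerivAt_abs_rpow_mul_self (by linarith : 1 < p - 2)
      (z - u)).comp u (hs u)).const_mul p)).congr_deriv ?_
    ring
  · refine ((((hasDerivAt_abs_rpow (z + u) (by linarith : 1 < p - 2)).comp u (ha u)).add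
      ((hasDerivAt_abs_rpow (z - u) (by linarith : 1 < p - 2)).comp u (hs u))).const_mul
      (p * (p - 1))).congr_deriv ?_
    rw [show p - 2 - 2 = p - 4 by ring]
    ring

lemma continuous_abs_rpow_mul_self {q : ℝ} (hq : 0 ≤ q) :
    Continuous fun x : ℝ => |x| ^ q * x :=
  (continuous_abs.rpow_const fun _ => Or.inr hq).mul continuous_id

lemma continuous_third_deriv_symmetrized {p : ℝ} (hp : 4 ≤ p) (z : ℝ) :
    Continuous fun u => p * (p - 1) * (p - 2) *
      (|z + u| ^ (p - 4) * (z + u) - |z - u| ^ (p - 4) * (z - u)) := by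
  have h := continuous_abs_rpow_mul_self (by linarith : 0 ≤ p - 4)
  have h1 : Continuous fun u => |z + u| ^ (p - 4) * (z + u) :=
    h.comp (continuous_const.add continuous_id)
  have h2 : Continuous fun u => |z - u| ^ (p - 4) * (z - u) :=
    h.comp (continuous_const.sub continuous_id)
  exact continuous_const.mul (h1.sub h2)

lemma third_deriv_symmetrized_nonneg {p : ℝ} (hp : 4 ≤ p) (z : ℝ) {u : ℝ} (hu : 0 ≤ u) :
    0 ≤ p * (p - 1) * (p - 2) *
      (|z + u| ^ (p - 4) * (z + u) - |z - u| ^ (p - 4) * (z - u)) := by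
  have h := monotone_abs_rpow_mul_self (by linarith : 0 ≤ p - 4) (by linarith : z - u ≤ z + u)
  dsimp only at h
  have h1 : 0 ≤ p * (p - 1) * (p - 2) := by
    have : 0 ≤ p - 1 := by linarith
    have : 0 ≤ p - 2 := by linarith
    positivity
  exact mul_nonneg h1 (by linarith)

/-- This is the second order Taylor polynomial in y; the remainder is nonnegative because x ↦
|x|^(p-4) x is increasing, which makes the third derivative nonnegative for y ≥ 0. -/
lemma two_mul_abs_rpow_add_le {p : ℝ} (hp : 4 ≤ p) (z y : ℝ) :
    2 * |z| ^ p + p * (p - 1) * y ^ 2 * |z| ^ (p - 2) ≤ |z + y| ^ p + |z - y| ^ p := by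
  wlog hy : 0 ≤ y generalizing y
  · have := this (-y) (by linarith)
    rw [neg_sq, ← sub_eq_add_neg, sub_neg_eq_add] at this
    linarith
  obtain ⟨h1, h2, h3⟩ := hasDerivAt_abs_rpow_symmetrized hp z
  have := taylor_three_of_deriv_eq_zero h1 h2 h3 (continuous_third_deriv_symmetrized hp z)
    (by simp) y
  simp only [add_zero, sub_zero] at this
  have hI := intervalIntegral.integral_nonneg (μ := volume) hy fun u hu =>
    mul_nonneg (by positivity : 0 ≤ (y - u) ^ 2 / 2) (third_deriv_symmetrized_nonneg hp z hu.1)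
  rw [this]
  linarith

/-! ### One summand: tails and moment recursions. -/

/-- A measurable symmetric real random variable with second moment `v` such that `|Y|` is
"new better than used". -/
structure IsSymmNBU {Ω : Type*} [MeasurableSpace Ω] (Y : Ω → ℝ) (P : Measure Ω) (v : ℝ) :
    Prop where
  meas : Measurable Y
  symm : IdentDistrib Y (fun ω => -Y ω) P P
  nbu : ∀ s t, 0 ≤ s → 0 ≤ t →
    P {ω | s + t ≤ |Y ω|} ≤ P {ω | s ≤ |Y ω|} * P {ω | t ≤ |Y ω|}
  sq : ∫⁻ ω, ENNReal.ofReal (Y ω ^ 2) ∂P = ENNReal.ofReal v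
  nonneg : 0 ≤ v

section

variable {Ω : Type*} [MeasurableSpace Ω] {P : Measure Ω}

namespace IsSymmNBU

variable {Y : Ω → ℝ} {v : ℝ}

lemma two_mul_lintegral_comp (hY : IsSymmNBU Y P v) {F : ℝ → ENNReal} (hF : Measurable F) :
    2 * ∫⁻ ω, F (Y ω) ∂P = ∫⁻ ω, F (Y ω) + F (-Y ω) ∂P := by
  have := (hY.symm.comp hF).lintegral_eq
  simp only [Function.comp_def] at this
  have hm := hY.meas
  rw [lintegral_add_left (by fun_prop), ← this, two_mul]

lemma two_mul_lintegral_abs_rpow (hY : IsSymmNBU Y P v) (z q : ℝ) :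
    2 * ∫⁻ ω, ENNReal.ofReal (|z + Y ω| ^ q) ∂P
      = ∫⁻ ω, ENNReal.ofReal (|z + Y ω| ^ q + |z - Y ω| ^ q) ∂P := by
  rw [hY.two_mul_lintegral_comp (F := fun y => ENNReal.ofReal (|z + y| ^ q)) (by fun_prop)]
  refine lintegral_congr fun ω => ?_
  rw [ENNReal.ofReal_add (by positivity) (by positivity), sub_eq_add_neg]

end IsSymmNBU

variable [IsProbabilityMeasure P]

/-- A concave function vanishing at 0 is subadditive, and here ln P(|X| ≥ 0) = 0. -/
lemma HasLogConcaveTails.measure_add_le {X : Ω → ℝ} (h : HasLogConcaveTails X P) {s t : ℝ}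
    (hs : 0 ≤ s) (ht : 0 ≤ t) :
    P {ω | s + t ≤ |X ω|} ≤ P {ω | s ≤ |X ω|} * P {ω | t ≤ |X ω|} := by
  rcases (add_nonneg hs ht).eq_or_lt with h0 | hpos
  · obtain rfl : s = 0 := by linarith
    obtain rfl : t = 0 := by linarith
    simp
  set x := P {ω | s + t ≤ |X ω|}
  -- Concavity between s + t and 0; the endpoint 0 contributes nothing since its probability is 1.
  have key : ∀ r r', 0 ≤ r → 0 ≤ r' → r + r' = s + t →
      x ^ (r / (s + t)) ≤ P {ω | r ≤ |X ω|} := by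
    intro r r' hr hr' hrr
    have := h (s + t) 0 (r / (s + t)) (r' / (s + t)) hpos.le le_rfl (by positivity)
      (by positivity) (by field_simp; linarith)
    rw [← ENNReal.log_le_log_iff, ENNReal.log_rpow]
    have h1 : r / (s + t) * (s + t) = r := by field_simp
    simpa [h1] using this
  have hx : x = x ^ (s / (s + t)) * x ^ (t / (s + t)) := by
    rw [← ENNReal.rpow_add_of_nonneg _ _ (by positivity) (by positivity), ← add_div,
      div_self hpos.ne', ENNReal.rpow_one]
  rw [hx]
  exact mul_le_mul' (key s t hs ht rfl) (key t s ht hs (add_comm _ _))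

lemma isSymmNBU_const_mul {X : Ω → ℝ} (hm : Measurable X) (hs : IsSymmetricRV X P)
    (ht : HasLogConcaveTails X P) (hv : ∫ ω, X ω ^ 2 ∂P = 1) (a : ℝ) :
    IsSymmNBU (fun ω => a * X ω) P (a ^ 2) where
  meas := hm.const_mul a
  symm := by
    have h1 : IdentDistrib X (fun ω => -X ω) P P := hs
    have := h1.comp (measurable_const_mul a)
    simpa [Function.comp_def] using this
  nbu s t hs0 ht0 := by
    rcases eq_or_ne a 0 with rfl | ha
    · rcases (add_nonneg hs0 ht0).eq_or_lt with h0 | hpos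
      · obtain rfl : s = 0 := by linarith
        obtain rfl : t = 0 := by linarith
        simp
      · have h1 : ¬ s + t ≤ 0 := hpos.not_ge
        simp [h1]
    · have ha' : 0 < |a| := abs_pos.2 ha
      have : ∀ r, {ω | r ≤ |a * X ω|} = {ω | r / |a| ≤ |X ω|} := fun r => by
        ext ω
        simp [abs_mul, div_le_iff₀' ha']
      rw [this, this, this, add_div]
      exact ht.measure_add_le (by positivity) (by positivity)
  sq := by
    have hint : Integrable (fun ω => X ω ^ 2) P := by
      by_contra h
      rw [integral_undef h] at hv
      exact zero_ne_one hv
    have := ofReal_integral_eq_lintegral_ofReal hint (ae_of_all _ fun ω => sq_nonneg (X ω))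
    rw [hv] at this
    simp_rw [mul_pow, ENNReal.ofReal_mul (sq_nonneg a)]
    rw [lintegral_const_mul _ (by fun_prop), ← this]
    simp
  nonneg := sq_nonneg a

namespace IsSymmNBU

variable {Y : Ω → ℝ} {v : ℝ}

/-- Layer cake: E(|Y|-u)₊² = 2∫ t P(|Y| ≥ t+u) dt, and the factor P(|Y| ≥ u) splits off, leaving 2∫
t P(|Y| ≥ t) dt = v. -/
lemma lintegral_max_sub_sq_le (hY : IsSymmNBU Y P v) {u : ℝ} (hu : 0 ≤ u) :
    ∫⁻ ω, ENNReal.ofReal (max (|Y ω| - u) 0 ^ 2) ∂P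
      ≤ ENNReal.ofReal v * P {ω | u ≤ |Y ω|} := by
  have hm := hY.meas
  have e1 := lintegral_rpow_eq_lintegral_meas_le_mul P (f := fun ω => max (|Y ω| - u) 0)
    (ae_of_all _ fun ω => le_max_right _ _) (by fun_prop) (p := 2) (by norm_num)
  have e2 := lintegral_rpow_eq_lintegral_meas_le_mul P (f := fun ω => |Y ω|)
    (ae_of_all _ fun ω => abs_nonneg _) (by fun_prop) (p := 2) (by norm_num)
  simp only [Real.rpow_two, sq_abs] at e1 e2
  rw [e1, ← hY.sq, e2, mul_assoc, ← lintegral_mul_const' _ _ (measure_ne_top _ _)]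
  refine mul_le_mul_right (lintegral_mono_ae
    ((ae_restrict_mem measurableSet_Ioi).mono fun t ht => ?_)) _
  have ht0 : 0 < t := ht
  have hset : {ω | t ≤ max (|Y ω| - u) 0} = {ω | t + u ≤ |Y ω|} := by
    ext ω
    simp [ht0.not_ge, le_sub_iff_add_le]
  rw [hset, mul_right_comm]
  exact mul_le_mul_left (hY.nbu t u ht0.le hu) _

/-- By symmetry of Y one may average over ±Y, which gives an even function of Y, hence a function of
T = |Y| to which the second derivative bound applies. The condition p ≥ 4 keeps the third derivative
continuous. -/
lemma lintegral_abs_add_rpow_le (hY : IsSymmNBU Y P v) {p : ℝ} (hp : 4 ≤ p) (z : ℝ) :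
    ∫⁻ ω, ENNReal.ofReal (|z + Y ω| ^ p) ∂P ≤ ENNReal.ofReal (|z| ^ p)
      + ENNReal.ofReal (p * (p - 1) / 2 * v) * ∫⁻ ω, ENNReal.ofReal (|z + Y ω| ^ (p - 2)) ∂P := by
  obtain ⟨h1, h2, h3⟩ := hasDerivAt_abs_rpow_symmetrized hp z
  have hm := hY.meas
  have hv := hY.nonneg
  have hpp : 0 ≤ p * (p - 1) := mul_nonneg (by linarith) (by linarith)
  have key := lintegral_le_add_lintegral_second_deriv (T := fun ω => |Y ω|) (P := P)
    (by fun_prop) (fun _ => abs_nonneg _) hY.nonneg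
    (fun u hu => hY.lintegral_max_sub_sq_le hu) h1 h2 h3 (continuous_third_deriv_symmetrized hp z)
    (by simp) (by positivity) (by positivity) (fun u hu => third_deriv_symmetrized_nonneg hp z hu)
  have habs : ∀ q : ℝ, ∀ y : ℝ, |(z + |y|)| ^ q + |(z - |y|)| ^ q = |z + y| ^ q + |z - y| ^ q := by
    intro q y
    rcases abs_choice y with h | h <;> rw [h]
    rw [sub_neg_eq_add, ← sub_eq_add_neg, add_comm]
  simp only [habs, add_zero, sub_zero, ENNReal.ofReal_mul hpp] at key
  rw [lintegral_const_mul _ (by fun_prop), ← hY.two_mul_lintegral_abs_rpow,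
    ← hY.two_mul_lintegral_abs_rpow, ← two_mul, ENNReal.ofReal_mul (by norm_num)] at key
  have h2' : (2 : ENNReal) ≠ 0 := by norm_num
  rw [← ENNReal.mul_le_mul_iff_right h2' (by simp)]
  refine key.trans (le_of_eq ?_)
  rw [mul_add, show p * (p - 1) / 2 * v = p * (p - 1) * (v / 2) by ring, ENNReal.ofReal_mul hpp]
  simp
  ring

lemma le_lintegral_abs_add_rpow (hY : IsSymmNBU Y P v) {p : ℝ} (hp : 4 ≤ p) (z : ℝ) :
    ENNReal.ofReal (|z| ^ p) + ENNReal.ofReal (p * (p - 1) / 2 * v)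
        * ENNReal.ofReal (|z| ^ (p - 2))
      ≤ ∫⁻ ω, ENNReal.ofReal (|z + Y ω| ^ p) ∂P := by
  have hm := hY.meas
  have hv := hY.nonneg
  have hpp : 0 ≤ p * (p - 1) := mul_nonneg (by linarith) (by linarith)
  have h2' : (2 : ENNReal) ≠ 0 := by norm_num
  rw [← ENNReal.mul_le_mul_iff_right h2' (by simp), hY.two_mul_lintegral_abs_rpow]
  refine le_trans (le_of_eq ?_)
    (lintegral_mono fun ω => ENNReal.ofReal_le_ofReal (two_mul_abs_rpow_add_le hp z (Y ω)))
  have : ∀ ω, ENNReal.ofReal (2 * |z| ^ p + p * (p - 1) * Y ω ^ 2 * |z| ^ (p - 2))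
      = ENNReal.ofReal (2 * |z| ^ p) +
        ENNReal.ofReal (p * (p - 1) * |z| ^ (p - 2)) * ENNReal.ofReal (Y ω ^ 2) := by
    intro ω
    rw [← ENNReal.ofReal_mul (by positivity), ← ENNReal.ofReal_add (by positivity) (by positivity)]
    congr 1; ring
  simp_rw [this]
  rw [lintegral_add_left measurable_const, lintegral_const_mul _ (by fun_prop), hY.sq,
    lintegral_const, measure_univ, mul_one, show (2 : ENNReal) = ENNReal.ofReal 2 by simp,
    ← ENNReal.ofReal_mul (by positivity), ← ENNReal.ofReal_mul (by positivity),
    ← ENNReal.ofReal_add (by positivity) (by positivity), ← ENNReal.ofReal_mul (by positivity),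
    ← ENNReal.ofReal_add (by positivity) (by positivity)]
  congr 1; ring

lemma lintegral_pow_four_le (hY : IsSymmNBU Y P v) :
    ∫⁻ ω, ENNReal.ofReal (Y ω ^ 4) ∂P ≤ ENNReal.ofReal (6 * v ^ 2) := by
  have := hY.lintegral_abs_add_rpow_le (p := 4) le_rfl 0
  have h4 : ∀ x : ℝ, |x| ^ (4 : ℝ) = x ^ 4 := fun x => by
    rw [show (4 : ℝ) = ((4 : ℕ) : ℝ) by norm_num, Real.rpow_natCast, (by decide : Even 4).pow_abs]
  have hv := hY.nonneg
  norm_num [h4, hY.sq] at this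
  refine this.trans (le_of_eq ?_)
  rw [ENNReal.ofReal_mul (by norm_num), pow_two, ENNReal.ofReal_mul hv]
  simp [mul_assoc]

/-- The upper recursion at z = 0 bounds the moment of order p by the one of order p - 2, so
finiteness climbs in steps of 2 from the fourth moment. -/
lemma lintegral_rpow_lt_top (hY : IsSymmNBU Y P v) (k : ℕ) :
    ∀ p : ℝ, 0 ≤ p → p < 4 + 2 * k → ∫⁻ ω, ENNReal.ofReal (|Y ω| ^ p) ∂P < ⊤ := by
  have hm := hY.meas
  have h4 : ∀ p : ℝ, 0 ≤ p → p < 4 → ∫⁻ ω, ENNReal.ofReal (|Y ω| ^ p) ∂P < ⊤ := by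
    intro p hp0 hp
    refine lt_of_le_of_lt (lintegral_mono (g := fun ω => 1 + ENNReal.ofReal (Y ω ^ 4))
      fun ω => ?_) ?_
    · dsimp only
      rw [← ENNReal.ofReal_one, ← ENNReal.ofReal_add (by positivity) (by positivity)]
      refine ENNReal.ofReal_le_ofReal ?_
      rcases le_total |Y ω| 1 with h | h
      · have := Real.rpow_le_one (abs_nonneg _) h hp0
        have : 0 ≤ Y ω ^ 4 := by positivity
        linarith
      · have := Real.rpow_le_rpow_of_exponent_le h hp.le
        rw [show (4 : ℝ) = ((4 : ℕ) : ℝ) by norm_num, Real.rpow_natCast,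
          (by decide : Even 4).pow_abs] at this
        linarith
    · rw [lintegral_add_left measurable_const]
      simpa using lt_of_le_of_lt hY.lintegral_pow_four_le ENNReal.ofReal_lt_top
  induction k with
  | zero => simpa using h4
  | succ k ih =>
    intro p hp0 hp
    rcases lt_or_ge p 4 with h | h
    · exact h4 p hp0 h
    · have h1 := ih (p - 2) (by linarith) (by push_cast at hp; linarith)
      have h2 := hY.lintegral_abs_add_rpow_le h 0
      simp only [zero_add] at h2
      exact lt_of_le_of_lt h2 (ENNReal.add_lt_top.2
        ⟨ENNReal.ofReal_lt_top, ENNReal.mul_lt_top ENNReal.ofReal_lt_top h1⟩)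

lemma memLp (hY : IsSymmNBU Y P v) {p : ℝ} (hp : 0 < p) : MemLp Y (ENNReal.ofReal p) P := by
  refine ⟨hY.meas.aestronglyMeasurable, ?_⟩
  rw [eLpNorm_lt_top_iff_lintegral_rpow_enorm_lt_top (by simpa using hp) ENNReal.ofReal_ne_top,
    ENNReal.toReal_ofReal hp.le]
  obtain ⟨k, hk⟩ := exists_nat_gt p
  have := hY.lintegral_rpow_lt_top k p hp.le (by linarith [(Nat.cast_nonneg k : (0 : ℝ) ≤ k)])
  simpa only [Real.enorm_eq_ofReal_abs, ENNReal.ofReal_rpow_of_nonneg (abs_nonneg _) hp.le]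
    using this

lemma lintegral_add_eq_of_indepFun (hY : IsSymmNBU Y P v) {Z : Ω → ℝ} (hZ : Measurable Z)
    (h : IndepFun Z Y P) {F : ℝ → ENNReal} (hF : Measurable F) :
    ∫⁻ ω, F (Z ω + Y ω) ∂P = ∫⁻ ω, ∫⁻ ω', F (Z ω + Y ω') ∂P ∂P := by
  have hm := hY.meas
  have h1 := (indepFun_iff_map_prod_eq_prod_map_map hZ.aemeasurable hm.aemeasurable).1 h
  have hF2 : Measurable fun x : ℝ × ℝ => F (x.1 + x.2) := by fun_prop
  have : ∫⁻ ω, F (Z ω + Y ω) ∂P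
      = ∫⁻ x : ℝ × ℝ, F (x.1 + x.2) ∂(Measure.map (fun ω => (Z ω, Y ω)) P) := by
    rw [lintegral_map hF2 (by fun_prop)]
  have hprob := Measure.isProbabilityMeasure_map (μ := P) hm.aemeasurable
  rw [this, h1, lintegral_prod _ hF2.aemeasurable,
    lintegral_map (by exact hF2.lintegral_prod_right') hZ]
  refine lintegral_congr fun ω => ?_
  rw [lintegral_map (by fun_prop) hm]

lemma lintegral_indep_add_rpow_le (hY : IsSymmNBU Y P v) {Z : Ω → ℝ} (hZ : Measurable Z)
    (h : IndepFun Z Y P) {p : ℝ} (hp : 4 ≤ p) :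
    ∫⁻ ω, ENNReal.ofReal (|Z ω + Y ω| ^ p) ∂P ≤ ∫⁻ ω, ENNReal.ofReal (|Z ω| ^ p) ∂P
      + ENNReal.ofReal (p * (p - 1) / 2 * v)
        * ∫⁻ ω, ENNReal.ofReal (|Z ω + Y ω| ^ (p - 2)) ∂P := by
  rw [hY.lintegral_add_eq_of_indepFun hZ h (F := fun x => ENNReal.ofReal (|x| ^ p)) (by fun_prop),
    hY.lintegral_add_eq_of_indepFun hZ h (F := fun x => ENNReal.ofReal (|x| ^ (p - 2)))
      (by fun_prop), ← lintegral_const_mul' _ _ ENNReal.ofReal_ne_top,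
      ← lintegral_add_left (by fun_prop)]
  exact lintegral_mono fun ω => hY.lintegral_abs_add_rpow_le hp (Z ω)

lemma le_lintegral_indep_add_rpow (hY : IsSymmNBU Y P v) {Z : Ω → ℝ} (hZ : Measurable Z)
    (h : IndepFun Z Y P) {p : ℝ} (hp : 4 ≤ p) :
    ∫⁻ ω, ENNReal.ofReal (|Z ω| ^ p) ∂P
        + ENNReal.ofReal (p * (p - 1) / 2 * v) * ∫⁻ ω, ENNReal.ofReal (|Z ω| ^ (p - 2)) ∂P
      ≤ ∫⁻ ω, ENNReal.ofReal (|Z ω + Y ω| ^ p) ∂P := by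
  rw [hY.lintegral_add_eq_of_indepFun hZ h (F := fun x => ENNReal.ofReal (|x| ^ p)) (by fun_prop),
    ← lintegral_const_mul' _ _ ENNReal.ofReal_ne_top, ← lintegral_add_left (by fun_prop)]
  exact lintegral_mono fun ω => hY.le_lintegral_abs_add_rpow hp (Z ω)

end IsSymmNBU

end

/-! ### Fourier representation of moments of order between 2 and 4. -/

/-- Taylor's formula applied to u⁴/24 - cos u, whose third derivative u - sin u is nonnegative for u
≥ 0. -/
lemma Real.cos_le_one_sub_sq_add_pow_four (x : ℝ) : Real.cos x ≤ 1 - x ^ 2 / 2 + x ^ 4 / 24 := by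
  wlog hx : 0 ≤ x generalizing x
  · simpa [(by decide : Even 4).neg_pow] using this (-x) (by linarith)
  have h1 : ∀ x : ℝ, HasDerivAt (fun u => u ^ 4 / 24 - Real.cos u) (x ^ 3 / 6 + Real.sin x) x :=
    fun x => (((hasDerivAt_pow 4 x).div_const 24).sub (Real.hasDerivAt_cos x)).congr_deriv
      (by norm_num; ring)
  have h2 : ∀ x : ℝ, HasDerivAt (fun x => x ^ 3 / 6 + Real.sin x) (x ^ 2 / 2 + Real.cos x) x :=
    fun x => (((hasDerivAt_pow 3 x).div_const 6).add (Real.hasDerivAt_sin x)).congr_deriv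
      (by norm_num; ring)
  have h3 : ∀ x : ℝ, HasDerivAt (fun x => x ^ 2 / 2 + Real.cos x) (x - Real.sin x) x :=
    fun x => (((hasDerivAt_pow 2 x).div_const 2).add (Real.hasDerivAt_cos x)).congr_deriv
      (by norm_num; ring)
  have := taylor_three_of_deriv_eq_zero h1 h2 h3 (by fun_prop) (by simp) x
  have hI : 0 ≤ ∫ u in (0 : ℝ)..x, (x - u) ^ 2 / 2 * (u - Real.sin u) :=
    intervalIntegral.integral_nonneg hx fun u hu =>
      mul_nonneg (by positivity) (by linarith [Real.sin_le hu.1])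
  simp at this
  linarith

/-- The remainder `cos u - 1 + u² / 2` of the second order Taylor expansion of the cosine. -/
noncomputable def cosRemainder (u : ℝ) : ℝ := Real.cos u - 1 + u ^ 2 / 2

lemma cosRemainder_nonneg (u : ℝ) : 0 ≤ cosRemainder u := by
  have := Real.one_sub_sq_div_two_le_cos (x := u)
  unfold cosRemainder; linarith

lemma continuous_cosRemainder : Continuous cosRemainder := by
  unfold cosRemainder; fun_prop

/-- The remainder is O(t⁴) at 0 and O(t²) at infinity, so both ends converge exactly because 2 < p <
4. -/
lemma integrableOn_cosRemainder_mul_rpow {p : ℝ} (hp : 2 < p) (hp' : p < 4) :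
    IntegrableOn (fun t : ℝ => cosRemainder t * t ^ (-p - 1)) (Set.Ioi 0) := by
  have hm : AEStronglyMeasurable (fun t : ℝ => cosRemainder t * t ^ (-p - 1)) := by
    have := continuous_cosRemainder.measurable
    exact (by fun_prop : Measurable _).aestronglyMeasurable
  rw [← Set.Ioo_union_Ici_eq_Ioi (zero_lt_one' ℝ), integrableOn_union]
  constructor
  · have h : IntegrableOn (fun t : ℝ => t ^ (3 - p)) (Set.Ioo 0 1) :=
      (intervalIntegral.integrableOn_Ioo_rpow_iff zero_lt_one).2 (by linarith)
    refine Integrable.mono' h hm.restrict ((ae_restrict_mem measurableSet_Ioo).mono fun t ht => ?_)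
    have ht0 : 0 < t := ht.1
    have hK := cosRemainder_nonneg t
    rw [Real.norm_of_nonneg (by positivity)]
    have h1 : cosRemainder t ≤ t ^ 4 := by
      have := Real.cos_le_one_sub_sq_add_pow_four t
      have : 0 ≤ t ^ 4 := by positivity
      unfold cosRemainder; linarith
    calc cosRemainder t * t ^ (-p - 1) ≤ t ^ 4 * t ^ (-p - 1) := by gcongr
      _ = t ^ (3 - p) := by
        rw [← Real.rpow_natCast, ← Real.rpow_add ht0]; congr 1; norm_num; ring
  · rw [integrableOn_Ici_iff_integrableOn_Ioi]
    have h : IntegrableOn (fun t : ℝ => t ^ (1 - p)) (Set.Ioi 1) :=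
      integrableOn_Ioi_rpow_of_lt (by linarith) zero_lt_one
    refine Integrable.mono' h hm.restrict ((ae_restrict_mem measurableSet_Ioi).mono fun t ht => ?_)
    have ht0 : 0 < t := lt_trans zero_lt_one ht
    have hK := cosRemainder_nonneg t
    rw [Real.norm_of_nonneg (by positivity)]
    have h1 : cosRemainder t ≤ t ^ 2 := by
      have := Real.cos_le_one t
      have : 0 ≤ t ^ 2 := by positivity
      unfold cosRemainder; linarith
    calc cosRemainder t * t ^ (-p - 1) ≤ t ^ 2 * t ^ (-p - 1) := by gcongr
      _ = t ^ (1 - p) := by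
        rw [← Real.rpow_natCast, ← Real.rpow_add ht0]; congr 1; norm_num; ring

lemma integral_cosRemainder_pos {p : ℝ} (hp : 2 < p) (hp' : p < 4) :
    0 < ∫ t in Set.Ioi (0 : ℝ), cosRemainder t * t ^ (-p - 1) := by
  rw [setIntegral_pos_iff_support_of_nonneg_ae _ (integrableOn_cosRemainder_mul_rpow hp hp')]
  · have : Set.Ioi (2 : ℝ) ⊆
        Function.support (fun t : ℝ => cosRemainder t * t ^ (-p - 1)) ∩ Set.Ioi 0 := by
      intro t ht
      have ht2 : (2 : ℝ) < t := ht
      have ht0 : 0 < t := by linarith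
      refine ⟨(mul_pos ?_ (by positivity)).ne', ht0⟩
      have := Real.neg_one_le_cos t
      unfold cosRemainder
      nlinarith
    exact lt_of_lt_of_le (by simp) (measure_mono this)
  · exact (ae_restrict_mem measurableSet_Ioi).mono fun t ht =>
      mul_nonneg (cosRemainder_nonneg t) (Real.rpow_nonneg (le_of_lt ht) _)

/-- The remainder is even, and the substitution t ↦ |x|t extracts |x|^p. -/
lemma lintegral_cosRemainder_mul {p : ℝ} (hp : 2 < p) (hp' : p < 4) (x : ℝ) :
    ∫⁻ t in Set.Ioi (0 : ℝ), ENNReal.ofReal (cosRemainder (t * x)) * ENNReal.ofReal (t ^ (-p - 1))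
      = ENNReal.ofReal (∫ t in Set.Ioi (0 : ℝ), cosRemainder t * t ^ (-p - 1))
        * ENNReal.ofReal (|x| ^ p) := by
  have hx : ∀ t, cosRemainder (t * x) = cosRemainder (|x| * t) := fun t => by
    rcases abs_choice x with h | h <;> rw [h] <;> simp [cosRemainder, mul_comm]
  simp_rw [hx]
  rcases (abs_nonneg x).eq_or_lt with h0 | hpos
  · simp [← h0, cosRemainder, Real.zero_rpow (by linarith : p ≠ 0)]
  set y := |x|
  have hint := integrableOn_cosRemainder_mul_rpow hp hp'
  have he : ∀ t ∈ Set.Ioi (0 : ℝ), cosRemainder (y * t) * t ^ (-p - 1)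
      = y ^ (p + 1) * (cosRemainder (y * t) * (y * t) ^ (-p - 1)) := by
    intro t ht
    rw [Real.mul_rpow hpos.le (le_of_lt ht)]
    have : y ^ (p + 1) * y ^ (-p - 1) = 1 := by
      rw [← Real.rpow_add hpos]; simp
    linear_combination (-(cosRemainder (y * t) * t ^ (-p - 1))) * this
  have hint' : IntegrableOn (fun t => cosRemainder (y * t) * t ^ (-p - 1)) (Set.Ioi 0) := by
    rw [integrableOn_congr_fun he measurableSet_Ioi]
    refine Integrable.const_mul ?_ _
    rw [← IntegrableOn, integrableOn_Ioi_comp_mul_left_iff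
      (fun t => cosRemainder t * t ^ (-p - 1)) 0 hpos]
    simpa using hint
  have hnn : 0 ≤ᵐ[volume.restrict (Set.Ioi 0)] fun t => cosRemainder (y * t) * t ^ (-p - 1) :=
    (ae_restrict_mem measurableSet_Ioi).mono fun t ht =>
      mul_nonneg (cosRemainder_nonneg _) (Real.rpow_nonneg (le_of_lt ht) _)
  calc _ = ∫⁻ t in Set.Ioi (0 : ℝ), ENNReal.ofReal (cosRemainder (y * t) * t ^ (-p - 1)) := by
        simp_rw [ENNReal.ofReal_mul (cosRemainder_nonneg _)]
    _ = ENNReal.ofReal (∫ t in Set.Ioi (0 : ℝ), cosRemainder (y * t) * t ^ (-p - 1)) :=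
        (ofReal_integral_eq_lintegral_ofReal hint' hnn).symm
    _ = _ := by
        rw [setIntegral_congr_fun measurableSet_Ioi he, integral_const_mul,
          integral_comp_mul_left_Ioi (fun t => cosRemainder t * t ^ (-p - 1)) 0 hpos, mul_zero,
          ← ENNReal.ofReal_mul (integral_cosRemainder_pos hp hp').le, smul_eq_mul,
          Real.rpow_add hpos, Real.rpow_one]
        congr 1
        field_simp

lemma mul_lintegral_abs_rpow_eq {Ω : Type*} [MeasurableSpace Ω] {P : Measure Ω} [SFinite P]
    {S : Ω → ℝ} (hS : Measurable S) {p : ℝ} (hp : 2 < p) (hp' : p < 4) :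
    ENNReal.ofReal (∫ t in Set.Ioi (0 : ℝ), cosRemainder t * t ^ (-p - 1))
        * ∫⁻ ω, ENNReal.ofReal (|S ω| ^ p) ∂P
      = ∫⁻ t in Set.Ioi (0 : ℝ), (∫⁻ ω, ENNReal.ofReal (cosRemainder (t * S ω)) ∂P)
        * ENNReal.ofReal (t ^ (-p - 1)) := by
  have hmK := continuous_cosRemainder.measurable
  rw [← lintegral_const_mul' _ _ ENNReal.ofReal_ne_top]
  simp_rw [← lintegral_cosRemainder_mul hp hp']
  rw [lintegral_lintegral_swap (by unfold Function.uncurry; fun_prop)]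
  refine lintegral_congr fun t => ?_
  rw [lintegral_mul_const _ (by fun_prop)]

/-- Absolute moments of order `p ∈ (2, 4)` are monotone in `t ↦ E (cos (t S) - 1 + t² S² / 2)`. -/
lemma lintegral_abs_rpow_le_of_cosRemainder_le {Ω Ω' : Type*} [MeasurableSpace Ω]
    [MeasurableSpace Ω'] {P : Measure Ω} {Q : Measure Ω'} [SFinite P] [SFinite Q] {S : Ω → ℝ}
    {T : Ω' → ℝ} (hS : Measurable S) (hT : Measurable T) {p : ℝ} (hp : 2 < p) (hp' : p < 4)
    (h : ∀ t, ∫⁻ ω, ENNReal.ofReal (cosRemainder (t * S ω)) ∂P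
      ≤ ∫⁻ ω, ENNReal.ofReal (cosRemainder (t * T ω)) ∂Q) :
    ∫⁻ ω, ENNReal.ofReal (|S ω| ^ p) ∂P ≤ ∫⁻ ω, ENNReal.ofReal (|T ω| ^ p) ∂Q := by
  have hC := integral_cosRemainder_pos hp hp'
  rw [← ENNReal.mul_le_mul_iff_right (ENNReal.ofReal_pos.2 hC).ne' ENNReal.ofReal_ne_top,
    mul_lintegral_abs_rpow_eq hS hp hp', mul_lintegral_abs_rpow_eq hT hp hp']
  exact lintegral_mono fun t => mul_le_mul_left (h t) _

lemma lintegral_cosRemainder_eq {Ω : Type*} [MeasurableSpace Ω] {P : Measure Ω}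
    [IsProbabilityMeasure P] {S : Ω → ℝ} (hS : Measurable S) {v : ℝ} (hv : 0 ≤ v)
    (hsq : ∫⁻ ω, ENNReal.ofReal (S ω ^ 2) ∂P = ENNReal.ofReal v) (t : ℝ) :
    ∫⁻ ω, ENNReal.ofReal (cosRemainder (t * S ω)) ∂P
      = ENNReal.ofReal (∫ ω, Real.cos (t * S ω) ∂P - 1 + v * t ^ 2 / 2) := by
  have hint : Integrable (fun ω => S ω ^ 2) P := by
    refine (lintegral_ofReal_ne_top_iff_integrable (by fun_prop)
      (ae_of_all _ fun ω => sq_nonneg _)).1 ?_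
    rw [hsq]; exact ENNReal.ofReal_ne_top
  have hval : ∫ ω, S ω ^ 2 ∂P = v := by
    rw [integral_eq_lintegral_of_nonneg_ae (ae_of_all _ fun ω => sq_nonneg _) (by fun_prop), hsq,
      ENNReal.toReal_ofReal hv]
  have hcos : Integrable (fun ω => Real.cos (t * S ω)) P :=
    Integrable.of_bound (by fun_prop) 1 (ae_of_all _ fun ω => Real.abs_cos_le_one _)
  have he : (fun ω => cosRemainder (t * S ω))
      = fun ω => Real.cos (t * S ω) - 1 + t ^ 2 / 2 * S ω ^ 2 := by
    ext ω; unfold cosRemainder; ring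
  have hint2 : Integrable (fun ω => t ^ 2 / 2 * S ω ^ 2) P := hint.const_mul _
  have hint1 : Integrable (fun ω => Real.cos (t * S ω) - 1) P := hcos.sub (integrable_const 1)
  rw [← ofReal_integral_eq_lintegral_ofReal (by rw [he]; exact hint1.add hint2)
    (ae_of_all _ fun ω => cosRemainder_nonneg _), he, integral_add hint1 hint2,
    integral_sub hcos (integrable_const 1), integral_const_mul, hval]
  simp
  congr 1; ring

/-! ### Elementary exponential inequalities. -/

/-- Convexity gives exp(Ay) ≤ 1 - y + y exp A, and 1 - y ≤ exp(-y). -/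
lemma exp_add_mul_le {A y : ℝ} (hy : 0 ≤ y) (hy1 : y ≤ 1) :
    Real.exp (-A + A * y) ≤ Real.exp (-(A + y)) + y := by
  have h1 := convexOn_exp.2 (Set.mem_univ 0) (Set.mem_univ A) (by linarith : 0 ≤ 1 - y) hy
    (by ring)
  simp only [smul_eq_mul, mul_zero, zero_add, Real.exp_zero, mul_one] at h1
  have h2 := Real.add_one_le_exp (-y)
  rw [Real.exp_add, neg_add, Real.exp_add, mul_comm A y]
  have h3 : Real.exp (-A) * Real.exp A = 1 := by rw [← Real.exp_add]; simp
  nlinarith [Real.exp_pos (-A)]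

lemma one_sub_exp_neg_add_le {A : ℝ} (hA : 0 ≤ A) :
    1 - Real.exp (-A) + A ^ 2 / 4 * Real.exp (-A) ≤ A := by
  have h2 := Real.quadratic_le_exp_of_nonneg hA
  have h3 : Real.exp (-A) * Real.exp A = 1 := by rw [← Real.exp_add]; simp
  have hE := Real.exp_pos (-A)
  -- For A ≥ 1 the quadratic lower bound on exp A suffices; for A ≤ 1 one uses exp A · (1 - A/2)² ≤
  -- 1.
  suffices h : (1 - A) * Real.exp A ≤ 1 - A ^ 2 / 4 by nlinarith
  rcases le_total 1 A with h | h
  · nlinarith [pow_nonneg hA 3]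
  · have h4 := Real.add_one_le_exp (-(A / 2))
    have h5 : Real.exp A * (Real.exp (-(A / 2))) ^ 2 = 1 := by
      rw [← Real.exp_nat_mul, ← Real.exp_add]; simp; ring
    have h6 : (1 - A / 2) ^ 2 ≤ Real.exp (-(A / 2)) ^ 2 := by
      gcongr <;> linarith
    have h7 : Real.exp A * (1 - A / 2) ^ 2 ≤ 1 := by
      exact (mul_le_mul_of_nonneg_left h6 (Real.exp_pos A).le).trans h5.le
    have h8 : 1 - A ≤ (1 - A ^ 2 / 4) * (1 - A / 2) ^ 2 := by
      nlinarith [pow_nonneg hA 3, mul_nonneg (pow_nonneg hA 3) (sub_nonneg.2 h)]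
    calc (1 - A) * Real.exp A ≤ (1 - A ^ 2 / 4) * (1 - A / 2) ^ 2 * Real.exp A := by gcongr
      _ = (1 - A ^ 2 / 4) * (Real.exp A * (1 - A / 2) ^ 2) := by ring
      _ ≤ 1 - A ^ 2 / 4 := mul_le_of_le_one_right (by nlinarith) h7

/-- With y = θA, bound exp(θA) above by its chord on [0, A] and the right side below by its tangent;
what remains is θ times `one_sub_exp_neg_add_le`. -/
lemma exp_sub_le_exp_add {A y : ℝ} (hy : 0 ≤ y) (hyA : y ≤ A) :
    Real.exp (-(A - y)) - y ≤ Real.exp (-(A + A * y / 4)) := by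
  rcases hy.eq_or_lt with rfl | hy0
  · simp
  have hA : 0 < A := hy0.trans_le hyA
  obtain ⟨θ, hθ0, hθ1, rfl⟩ : ∃ θ, 0 ≤ θ ∧ θ ≤ 1 ∧ y = θ * A :=
    ⟨y / A, by positivity, by rw [div_le_one hA]; exact hyA, by field_simp⟩
  have h1 := convexOn_exp.2 (Set.mem_univ 0) (Set.mem_univ A) (by linarith : 0 ≤ 1 - θ) hθ0
    (by ring)
  simp only [smul_eq_mul, mul_zero, zero_add, Real.exp_zero, mul_one] at h1
  have h2 := Real.add_one_le_exp (-(A * (θ * A) / 4))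
  have h3 : Real.exp (-A) * Real.exp A = 1 := by rw [← Real.exp_add]; simp
  have h4 := one_sub_exp_neg_add_le hA.le
  have hE := Real.exp_pos (-A)
  rw [neg_add, Real.exp_add, show -(A - θ * A) = -A + θ * A by ring, Real.exp_add]
  have h5 := mul_le_mul_of_nonneg_left h1 hE.le
  have h6 := mul_le_mul_of_nonneg_left h2 hE.le
  have h7 := mul_le_mul_of_nonneg_left h4 hθ0
  nlinarith

lemma exp_neg_sub_sq_le {x : ℝ} (hx : 0 ≤ x) (hx' : x ≤ 1 / 2) :
    Real.exp (-x - x ^ 2) ≤ 1 - x := by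
  have h1 := Real.quadratic_le_exp_of_nonneg (by positivity : 0 ≤ x + x ^ 2)
  have h2 : Real.exp (-x - x ^ 2) * Real.exp (x + x ^ 2) = 1 := by
    rw [← Real.exp_add]; simp
  have h3 : 1 ≤ (1 - x) * (1 + (x + x ^ 2) + (x + x ^ 2) ^ 2 / 2) := by
    nlinarith [pow_nonneg hx 2, pow_nonneg hx 3, mul_nonneg (pow_nonneg hx 2) (sub_nonneg.2 hx'),
      mul_nonneg (pow_nonneg hx 3) (sub_nonneg.2 hx'), mul_nonneg (pow_nonneg hx 4) (sub_nonneg.2 hx')]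
  have h4 : 1 ≤ (1 - x) * Real.exp (x + x ^ 2) := h3.trans (by gcongr; linarith)
  nlinarith [Real.exp_pos (-x - x ^ 2)]

/-! ### Characteristic functions of sums. -/

section

variable {Ω : Type*} [MeasurableSpace Ω] {P : Measure Ω}

lemma indepFun_sum_of_notMem {ι : Type*} {Y : ι → Ω → ℝ} {v : ι → ℝ}
    (hY : ∀ i, IsSymmNBU (Y i) P (v i)) (hind : iIndepFun Y P)
    {s : Finset ι} {i : ι} (hi : i ∉ s) : IndepFun (fun ω => ∑ j ∈ s, Y j ω) (Y i) P := by
  have := hind.indepFun_finsetSum_of_notMem (fun i => (hY i).meas) hi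
  convert this using 1
  ext ω; simp

variable [IsProbabilityMeasure P]

namespace IsSymmNBU

variable {Y : Ω → ℝ} {v : ℝ}

lemma one_sub_le_integral_cos (hY : IsSymmNBU Y P v) (t : ℝ) :
    1 - v * t ^ 2 / 2 ≤ ∫ ω, Real.cos (t * Y ω) ∂P := by
  have hm := hY.meas
  have hv := hY.nonneg
  have h4 : Integrable (fun ω => Y ω ^ 2) P := by
    refine (lintegral_ofReal_ne_top_iff_integrable (by fun_prop)
      (ae_of_all _ fun ω => sq_nonneg _)).1 ?_
    rw [hY.sq]; exact ENNReal.ofReal_ne_top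
  have hval : ∫ ω, Y ω ^ 2 ∂P = v := by
    rw [integral_eq_lintegral_of_nonneg_ae (ae_of_all _ fun ω => sq_nonneg _) (by fun_prop),
      hY.sq, ENNReal.toReal_ofReal hv]
  have hcos : Integrable (fun ω => Real.cos (t * Y ω)) P :=
    Integrable.of_bound (by fun_prop) 1 (ae_of_all _ fun ω => Real.abs_cos_le_one _)
  have : ∫ ω, (1 - t ^ 2 / 2 * Y ω ^ 2) ∂P ≤ ∫ ω, Real.cos (t * Y ω) ∂P :=
    integral_mono ((integrable_const 1).sub (h4.const_mul _)) hcos fun ω => by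
      have := Real.one_sub_sq_div_two_le_cos (x := t * Y ω)
      dsimp only
      linarith [mul_pow t (Y ω) 2]
  rw [integral_sub (integrable_const 1) (h4.const_mul _), integral_const_mul, hval] at this
  simp at this
  linarith

/-- With x = vt²/2, the fourth moment bound gives t⁴/24 · 6v² = x² exactly. The bound 1 - x from
below also handles the absolute value, as (x-1)² + 1 ≥ 0. -/
lemma abs_integral_cos_le (hY : IsSymmNBU Y P v) (t : ℝ) :
    |∫ ω, Real.cos (t * Y ω) ∂P| ≤ 1 - v * t ^ 2 / 2 + (v * t ^ 2 / 2) ^ 2 := by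
  have hm := hY.meas
  have hv := hY.nonneg
  have hlow := hY.one_sub_le_integral_cos t
  have hup : ∫ ω, Real.cos (t * Y ω) ∂P - 1 + v * t ^ 2 / 2 ≤ (v * t ^ 2 / 2) ^ 2 := by
    have h := lintegral_cosRemainder_eq hm hv hY.sq t
    have h2 : ∫⁻ ω, ENNReal.ofReal (cosRemainder (t * Y ω)) ∂P
        ≤ ENNReal.ofReal (t ^ 4 / 24) * ENNReal.ofReal (6 * v ^ 2) := by
      refine le_trans ?_ (mul_le_mul_right hY.lintegral_pow_four_le _)
      rw [← lintegral_const_mul' _ _ ENNReal.ofReal_ne_top]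
      refine lintegral_mono fun ω => ?_
      rw [← ENNReal.ofReal_mul (by positivity)]
      refine ENNReal.ofReal_le_ofReal ?_
      have := Real.cos_le_one_sub_sq_add_pow_four (t * Y ω)
      unfold cosRemainder
      linarith [mul_pow t (Y ω) 4]
    rw [h, ← ENNReal.ofReal_mul (by positivity), ENNReal.ofReal_le_ofReal_iff (by positivity)] at h2
    linarith
  rw [abs_le]
  constructor <;> nlinarith [sq_nonneg (v * t ^ 2 / 2 - 1)]

lemma integral_cos_add (hY : IsSymmNBU Y P v) {Z : Ω → ℝ} (hZ : Measurable Z)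
    (h : IndepFun Z Y P) (t : ℝ) :
    ∫ ω, Real.cos (t * (Z ω + Y ω)) ∂P
      = (∫ ω, Real.cos (t * Z ω) ∂P) * ∫ ω, Real.cos (t * Y ω) ∂P := by
  have hm := hY.meas
  have hc : IndepFun (fun ω => Real.cos (t * Z ω)) (fun ω => Real.cos (t * Y ω)) P :=
    h.comp (φ := fun x => Real.cos (t * x)) (ψ := fun x => Real.cos (t * x)) (by fun_prop)
      (by fun_prop)
  have hs : IndepFun (fun ω => Real.sin (t * Z ω)) (fun ω => Real.sin (t * Y ω)) P :=
    h.comp (φ := fun x => Real.sin (t * x)) (ψ := fun x => Real.sin (t * x)) (by fun_prop)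
      (by fun_prop)
  -- Symmetry kills the sine term of the addition formula.
  have hsin : ∫ ω, Real.sin (t * Y ω) ∂P = 0 := by
    have := (hY.symm.comp (u := fun x => Real.sin (t * x)) (by fun_prop)).integral_eq
    simp only [Function.comp_def, mul_neg, Real.sin_neg, integral_neg] at this
    linarith
  simp_rw [mul_add, Real.cos_add]
  rw [integral_sub, hc.integral_fun_mul_eq_mul_integral (by fun_prop) (by fun_prop),
    hs.integral_fun_mul_eq_mul_integral (by fun_prop) (by fun_prop), hsin, mul_zero, sub_zero]
  · exact Integrable.of_bound (by fun_prop) 1 (ae_of_all _ fun ω => by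
      rw [norm_mul]
      exact mul_le_one₀ (Real.abs_cos_le_one _) (norm_nonneg _) (Real.abs_cos_le_one _))
  · exact Integrable.of_bound (by fun_prop) 1 (ae_of_all _ fun ω => by
      rw [norm_mul]
      exact mul_le_one₀ (Real.abs_sin_le_one _) (norm_nonneg _) (Real.abs_sin_le_one _))

lemma lintegral_add_sq (hY : IsSymmNBU Y P v) {Z : Ω → ℝ} (hZ : Measurable Z)
    (h : IndepFun Z Y P) :
    ∫⁻ ω, ENNReal.ofReal ((Z ω + Y ω) ^ 2) ∂P
      = ∫⁻ ω, ENNReal.ofReal (Z ω ^ 2) ∂P + ENNReal.ofReal v := by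
  have hm := hY.meas
  rw [hY.lintegral_add_eq_of_indepFun hZ h (F := fun x => ENNReal.ofReal (x ^ 2)) (by fun_prop)]
  have : ∀ z : ℝ, ∫⁻ ω, ENNReal.ofReal ((z + Y ω) ^ 2) ∂P
      = ENNReal.ofReal (z ^ 2) + ENNReal.ofReal v := by
    intro z
    have h2 : (2 : ENNReal) ≠ 0 := by norm_num
    rw [← ENNReal.mul_right_inj h2 (by simp),
      hY.two_mul_lintegral_comp (F := fun y => ENNReal.ofReal ((z + y) ^ 2)) (by fun_prop),
      ← hY.sq, mul_add, ← lintegral_const_mul _ (by fun_prop)]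
    have he : ∀ ω, ENNReal.ofReal ((z + Y ω) ^ 2) + ENNReal.ofReal ((z + -Y ω) ^ 2)
        = 2 * ENNReal.ofReal (z ^ 2) + 2 * ENNReal.ofReal (Y ω ^ 2) := by
      intro ω
      rw [show (2 : ENNReal) = ENNReal.ofReal 2 by simp, ← ENNReal.ofReal_mul (by positivity),
        ← ENNReal.ofReal_mul (by positivity), ← ENNReal.ofReal_add (by positivity) (by positivity),
        ← ENNReal.ofReal_add (by positivity) (by positivity)]
      congr 1; ring
    simp_rw [he]
    rw [lintegral_add_left (by fun_prop)]
    simp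
  simp_rw [this]
  rw [lintegral_add_left (by fun_prop)]
  simp

end IsSymmNBU

section Sums

variable {ι : Type*} {Y : ι → Ω → ℝ} {v : ι → ℝ}

lemma integral_cos_sum (hY : ∀ i, IsSymmNBU (Y i) P (v i)) (hind : iIndepFun Y P)
    (s : Finset ι) (t : ℝ) :
    ∫ ω, Real.cos (t * ∑ i ∈ s, Y i ω) ∂P = ∏ i ∈ s, ∫ ω, Real.cos (t * Y i ω) ∂P := by
  classical
  have hm : ∀ i, Measurable (Y i) := fun i => (hY i).meas
  induction s using Finset.induction_on with
  | empty => simp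
  | insert i s hi ih =>
    simp_rw [Finset.sum_insert hi, Finset.prod_insert hi, add_comm (Y i _)]
    rw [(hY i).integral_cos_add (by fun_prop) (indepFun_sum_of_notMem hY hind hi), ih, mul_comm]

lemma lintegral_sum_sq (hY : ∀ i, IsSymmNBU (Y i) P (v i)) (hind : iIndepFun Y P)
    (s : Finset ι) :
    ∫⁻ ω, ENNReal.ofReal ((∑ i ∈ s, Y i ω) ^ 2) ∂P = ENNReal.ofReal (∑ i ∈ s, v i) := by
  classical
  have hm : ∀ i, Measurable (Y i) := fun i => (hY i).meas
  induction s using Finset.induction_on with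
  | empty => simp
  | insert i s hi ih =>
    simp_rw [Finset.sum_insert hi, add_comm (Y i _)]
    rw [(hY i).lintegral_add_sq (by fun_prop) (indepFun_sum_of_notMem hY hind hi), ih, add_comm,
      ENNReal.ofReal_add (hY i).nonneg (Finset.sum_nonneg fun j _ => (hY j).nonneg)]

lemma sum_mul_sq_le {s : Finset ι} {x : ι → ℝ} {m : ℝ} (h0 : ∀ i ∈ s, 0 ≤ x i)
    (hm : ∀ i ∈ s, x i ≤ m) : ∑ i ∈ s, x i ^ 2 ≤ (∑ i ∈ s, x i) * m := by
  rw [Finset.sum_mul]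
  exact Finset.sum_le_sum fun i hi => by
    rw [sq]; exact mul_le_mul_of_nonneg_left (hm i hi) (h0 i hi)

/-- The extra Mt²/2 is the change in the quadratic term when the variance grows from σ² to σ² + M,
so this is the comparison of cosine remainders with a Gaussian of variance σ² + M. -/
lemma integral_cos_sum_le (hY : ∀ i, IsSymmNBU (Y i) P (v i)) (hind : iIndepFun Y P)
    (s : Finset ι) {M : ℝ} (hM : 0 ≤ M) (hv : ∀ i ∈ s, v i ≤ M) (t : ℝ) :
    ∫ ω, Real.cos (t * ∑ i ∈ s, Y i ω) ∂P
      ≤ Real.exp (-((∑ i ∈ s, v i) + M) * t ^ 2 / 2) + M * t ^ 2 / 2 := by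
  have hle1 : ∫ ω, Real.cos (t * ∑ i ∈ s, Y i ω) ∂P ≤ 1 := by
    refine (le_abs_self _).trans ?_
    have := norm_integral_le_of_norm_le_const (μ := P) (C := 1)
      (f := fun ω => Real.cos (t * ∑ i ∈ s, Y i ω)) (ae_of_all _ fun ω => Real.abs_cos_le_one _)
    simpa using this
  rcases le_total 1 (M * t ^ 2 / 2) with h | h
  · linarith [Real.exp_pos (-((∑ i ∈ s, v i) + M) * t ^ 2 / 2)]
  set A := (∑ i ∈ s, v i) * t ^ 2 / 2
  have hA : ∑ i ∈ s, v i * t ^ 2 / 2 = A := by rw [← Finset.sum_div, ← Finset.sum_mul]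
  calc ∫ ω, Real.cos (t * ∑ i ∈ s, Y i ω) ∂P
      ≤ ∏ i ∈ s, |∫ ω, Real.cos (t * Y i ω) ∂P| := by
        rw [integral_cos_sum hY hind, ← Finset.abs_prod]; exact le_abs_self _
    _ ≤ ∏ i ∈ s, Real.exp (-(v i * t ^ 2 / 2) + (v i * t ^ 2 / 2) ^ 2) :=
        Finset.prod_le_prod (fun i _ => abs_nonneg _) fun i _ =>
          ((hY i).abs_integral_cos_le t).trans (by
            linarith [Real.add_one_le_exp (-(v i * t ^ 2 / 2) + (v i * t ^ 2 / 2) ^ 2)])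
    _ = Real.exp (-A + ∑ i ∈ s, (v i * t ^ 2 / 2) ^ 2) := by
        rw [← Real.exp_sum, Finset.sum_add_distrib, Finset.sum_neg_distrib, hA]
    _ ≤ Real.exp (-A + A * (M * t ^ 2 / 2)) := by
        gcongr
        rw [← hA]
        exact sum_mul_sq_le (fun i _ => by have := (hY i).nonneg; positivity)
          fun i hi => by have := hv i hi; gcongr
    _ ≤ Real.exp (-(A + M * t ^ 2 / 2)) + M * t ^ 2 / 2 := exp_add_mul_le (by positivity) h
    _ = _ := by congr 2; simp only [A]; ring

/-- The mirror comparison, with variance σ² - 4M. The factor 4 makes the left side at most 1 - 2 =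
-1 once Mt²/2 ≥ 1/2, and below that threshold 1 - x ≥ exp(-x - x²) applies to every factor. -/
lemma le_integral_cos_sum (hY : ∀ i, IsSymmNBU (Y i) P (v i)) (hind : iIndepFun Y P)
    (s : Finset ι) {M : ℝ} (hM : 0 ≤ M) (hv : ∀ i ∈ s, v i ≤ M) (hs : 4 * M ≤ ∑ i ∈ s, v i)
    (t : ℝ) :
    Real.exp (-((∑ i ∈ s, v i) - 4 * M) * t ^ 2 / 2) - 4 * M * t ^ 2 / 2
      ≤ ∫ ω, Real.cos (t * ∑ i ∈ s, Y i ω) ∂P := by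
  have hle1 : -1 ≤ ∫ ω, Real.cos (t * ∑ i ∈ s, Y i ω) ∂P := by
    refine (abs_le.1 ?_).1
    have := norm_integral_le_of_norm_le_const (μ := P) (C := 1)
      (f := fun ω => Real.cos (t * ∑ i ∈ s, Y i ω)) (ae_of_all _ fun ω => Real.abs_cos_le_one _)
    simpa using this
  rcases le_total (1 / 2) (M * t ^ 2 / 2) with h | h
  · have : Real.exp (-((∑ i ∈ s, v i) - 4 * M) * t ^ 2 / 2) ≤ 1 :=
      Real.exp_le_one_iff.2 (by nlinarith [sq_nonneg t])
    linarith
  set A := (∑ i ∈ s, v i) * t ^ 2 / 2 with hAdef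
  have hA : ∑ i ∈ s, v i * t ^ 2 / 2 = A := by rw [← Finset.sum_div, ← Finset.sum_mul]
  have hx : ∀ i ∈ s, 0 ≤ v i * t ^ 2 / 2 := fun i _ => by have := (hY i).nonneg; positivity
  have hxm : ∀ i ∈ s, v i * t ^ 2 / 2 ≤ M * t ^ 2 / 2 := fun i hi => by have := hv i hi; gcongr
  calc Real.exp (-((∑ i ∈ s, v i) - 4 * M) * t ^ 2 / 2) - 4 * M * t ^ 2 / 2
      = Real.exp (-(A - 4 * (M * t ^ 2 / 2))) - 4 * (M * t ^ 2 / 2) := by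
        rw [hAdef]; congr 2 <;> ring
    _ ≤ Real.exp (-(A + A * (4 * (M * t ^ 2 / 2)) / 4)) :=
        exp_sub_le_exp_add (by positivity) (by rw [hAdef]; nlinarith [sq_nonneg t])
    _ ≤ Real.exp (-A - ∑ i ∈ s, (v i * t ^ 2 / 2) ^ 2) := by
        have := sum_mul_sq_le hx hxm
        rw [hA] at this
        gcongr
        linarith
    _ = ∏ i ∈ s, Real.exp (-(v i * t ^ 2 / 2) - (v i * t ^ 2 / 2) ^ 2) := by
        rw [← Real.exp_sum, Finset.sum_sub_distrib, Finset.sum_neg_distrib, hA]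
    _ ≤ ∏ i ∈ s, ∫ ω, Real.cos (t * Y i ω) ∂P :=
        Finset.prod_le_prod (fun i _ => (Real.exp_pos _).le) fun i hi =>
          (exp_neg_sub_sq_le (hx i hi) ((hxm i hi).trans h)).trans
            ((hY i).one_sub_le_integral_cos t)
    _ = _ := (integral_cos_sum hY hind s t).symm

end Sums

end

/-! ### Gaussian moments. -/

/-- The absolute moment `E |G| ^ p` of a standard Gaussian random variable. -/
noncomputable def gaussianAbsMoment (p : ℝ) : ℝ := ∫ x, |x| ^ p ∂(gaussianReal 0 1)

lemma gaussianAbsMoment_eq {p : ℝ} (hp : -1 < p) :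
    gaussianAbsMoment p = (√(2 * Real.pi))⁻¹ * (1 / 2) ^ (-(p + 1) / 2)
      * Real.Gamma ((p + 1) / 2) := by
  have h := integral_comp_abs (f := fun x => x ^ p * Real.exp (-(1 / 2) * x ^ (2 : ℝ)))
  rw [integral_rpow_mul_exp_neg_mul_rpow (by norm_num) hp (by norm_num)] at h
  rw [gaussianAbsMoment, integral_gaussianReal_eq_integral_smul one_ne_zero]
  have : ∀ x : ℝ, gaussianPDFReal 0 1 x • |x| ^ p
      = (√(2 * Real.pi))⁻¹ * (|x| ^ p * Real.exp (-(1 / 2) * |x| ^ (2 : ℝ))) := by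
    intro x
    rw [gaussianPDFReal, Real.rpow_two, sq_abs, smul_eq_mul]
    simp
    ring_nf
  simp_rw [this]
  rw [integral_const_mul, h]
  ring

lemma gaussianAbsMoment_pos {p : ℝ} (hp : -1 < p) : 0 < gaussianAbsMoment p := by
  rw [gaussianAbsMoment_eq hp]
  have := Real.Gamma_pos_of_pos (by linarith : 0 < (p + 1) / 2)
  positivity

lemma gaussianAbsMoment_eq_mul {p : ℝ} (hp : 1 < p) :
    gaussianAbsMoment p = (p - 1) * gaussianAbsMoment (p - 2) := by
  rw [gaussianAbsMoment_eq (by linarith), gaussianAbsMoment_eq (by linarith),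
    show (p + 1) / 2 = (p - 2 + 1) / 2 + 1 by ring, Real.Gamma_add_one (by linarith),
    show -(p + 1) / 2 = -(p - 2 + 1) / 2 + (-1) by ring, Real.rpow_add (by norm_num),
    Real.rpow_neg_one]
  ring

lemma gaussianAbsMoment_two : gaussianAbsMoment 2 = 1 := by
  rw [gaussianAbsMoment_eq_mul (by norm_num)]
  norm_num [gaussianAbsMoment]

lemma lintegral_abs_rpow_gaussianReal {p : ℝ} (hp : -1 < p) :
    ∫⁻ x, ENNReal.ofReal (|x| ^ p) ∂(gaussianReal 0 1) = ENNReal.ofReal (gaussianAbsMoment p) := by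
  have h := gaussianAbsMoment_pos hp
  rw [gaussianAbsMoment, ofReal_integral_eq_lintegral_ofReal _
    (ae_of_all _ fun x => Real.rpow_nonneg (abs_nonneg x) p)]
  by_contra hc
  rw [gaussianAbsMoment, integral_undef hc] at h
  exact h.false

lemma lintegral_abs_sqrt_mul_rpow_gaussianReal {p w : ℝ} (hp : -1 < p) (hw : 0 ≤ w) :
    ∫⁻ x, ENNReal.ofReal (|√w * x| ^ p) ∂(gaussianReal 0 1)
      = ENNReal.ofReal (gaussianAbsMoment p * w ^ (p / 2)) := by
  simp_rw [abs_mul, Real.mul_rpow (abs_nonneg _) (abs_nonneg _),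
    ENNReal.ofReal_mul (Real.rpow_nonneg (abs_nonneg _) _)]
  rw [lintegral_const_mul' _ _ ENNReal.ofReal_ne_top, lintegral_abs_rpow_gaussianReal hp,
    ← ENNReal.ofReal_mul (by positivity), abs_of_nonneg (Real.sqrt_nonneg w), Real.sqrt_eq_rpow,
    ← Real.rpow_mul hw, mul_comm]
  congr 3; ring

lemma integral_cos_mul_gaussianReal (t : ℝ) :
    ∫ x, Real.cos (t * x) ∂(gaussianReal 0 1) = Real.exp (-t ^ 2 / 2) := by
  have h := charFun_gaussianReal (μ := 0) (v := 1) t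
  rw [charFun_apply_real] at h
  have hint : Integrable (fun x : ℝ => Complex.exp (t * x * Complex.I)) (gaussianReal 0 1) := by
    refine Integrable.of_bound (by fun_prop) 1 (ae_of_all _ fun x => le_of_eq ?_)
    rw [← Complex.ofReal_mul, Complex.norm_exp_ofReal_mul_I]
  have h2 := congrArg Complex.re h
  rw [← RCLike.re_eq_complex_re, ← integral_re hint] at h2
  have h3 : ∀ x : ℝ, Complex.re (Complex.exp (t * x * Complex.I)) = Real.cos (t * x) := fun x => by
    rw [← Complex.ofReal_mul, Complex.exp_ofReal_mul_I_re]
  simp only [RCLike.re_eq_complex_re, h3] at h2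
  rw [h2, show ((t : ℂ) * ((0 : ℝ) : ℂ) * Complex.I - (((1 : NNReal) : ℝ) : ℂ) * (t : ℂ) ^ 2 / 2)
    = ((-t ^ 2 / 2 : ℝ) : ℂ) by push_cast; ring, Complex.exp_ofReal_re]

lemma lintegral_cosRemainder_gaussianReal {w : ℝ} (hw : 0 ≤ w) (t : ℝ) :
    ∫⁻ x, ENNReal.ofReal (cosRemainder (t * (√w * x))) ∂(gaussianReal 0 1)
      = ENNReal.ofReal (Real.exp (-w * t ^ 2 / 2) - 1 + w * t ^ 2 / 2) := by
  rw [lintegral_cosRemainder_eq (by fun_prop) hw]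
  · simp_rw [← mul_assoc]
    rw [integral_cos_mul_gaussianReal, mul_pow, Real.sq_sqrt hw]
    congr 4; ring
  · have := lintegral_abs_sqrt_mul_rpow_gaussianReal (p := 2) (by norm_num) hw
    simpa only [Real.rpow_two, sq_abs, gaussianAbsMoment_two, one_mul, div_self (two_ne_zero' ℝ),
      Real.rpow_one] using this

/-! ### Moments of sums: base range and induction on the order. -/

section Moments

variable {Ω : Type*} [MeasurableSpace Ω] {P : Measure Ω} [IsProbabilityMeasure P]
  {ι : Type*} {Y : ι → Ω → ℝ} {v : ι → ℝ}

lemma lintegral_abs_sum_rpow_le_of_lt_four (hY : ∀ i, IsSymmNBU (Y i) P (v i))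
    (hind : iIndepFun Y P) {M : ℝ} (hM : 0 ≤ M) (hv : ∀ i, v i ≤ M) {p : ℝ} (hp : 2 ≤ p)
    (hp' : p < 4) (s : Finset ι) :
    ∫⁻ ω, ENNReal.ofReal (|∑ i ∈ s, Y i ω| ^ p) ∂P
      ≤ ENNReal.ofReal (gaussianAbsMoment p * ((∑ i ∈ s, v i) + M) ^ (p / 2)) := by
  have hm : ∀ i, Measurable (Y i) := fun i => (hY i).meas
  have hσ : 0 ≤ ∑ i ∈ s, v i := Finset.sum_nonneg fun i _ => (hY i).nonneg
  rcases hp.eq_or_lt with rfl | hp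
  · have := lintegral_sum_sq hY hind s
    simp only [Real.rpow_two, sq_abs, this, gaussianAbsMoment_two]
    exact ENNReal.ofReal_le_ofReal (by norm_num; linarith)
  · rw [← lintegral_abs_sqrt_mul_rpow_gaussianReal (by linarith) (by positivity)]
    refine lintegral_abs_rpow_le_of_cosRemainder_le (by fun_prop) (by fun_prop) hp hp' fun t => ?_
    rw [lintegral_cosRemainder_eq (by fun_prop) hσ (lintegral_sum_sq hY hind s),
      lintegral_cosRemainder_gaussianReal (by positivity)]
    have := integral_cos_sum_le hY hind s hM (fun i _ => hv i) t
    exact ENNReal.ofReal_le_ofReal (by linarith)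

lemma le_lintegral_abs_sum_rpow_of_lt_four (hY : ∀ i, IsSymmNBU (Y i) P (v i))
    (hind : iIndepFun Y P) {M : ℝ} (hM : 0 ≤ M) (hv : ∀ i, v i ≤ M) {p : ℝ} (hp : 2 ≤ p)
    (hp' : p < 4) (s : Finset ι) :
    ENNReal.ofReal (gaussianAbsMoment p * (max 0 ((∑ i ∈ s, v i) - 4 * M)) ^ (p / 2))
      ≤ ∫⁻ ω, ENNReal.ofReal (|∑ i ∈ s, Y i ω| ^ p) ∂P := by
  have hm : ∀ i, Measurable (Y i) := fun i => (hY i).meas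
  have hσ : 0 ≤ ∑ i ∈ s, v i := Finset.sum_nonneg fun i _ => (hY i).nonneg
  rcases le_total (∑ i ∈ s, v i) (4 * M) with h | h
  · rw [max_eq_left (by linarith), Real.zero_rpow (by linarith)]
    simp
  have h' : 0 ≤ ∑ i ∈ s, v i - 4 * M := by linarith
  rw [max_eq_right h']
  rcases hp.eq_or_lt with rfl | hp
  · have := lintegral_sum_sq hY hind s
    simp only [Real.rpow_two, sq_abs, this, gaussianAbsMoment_two]
    exact ENNReal.ofReal_le_ofReal (by norm_num; linarith)
  · rw [← lintegral_abs_sqrt_mul_rpow_gaussianReal (by linarith) h']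
    refine lintegral_abs_rpow_le_of_cosRemainder_le (by fun_prop) (by fun_prop) hp hp' fun t => ?_
    rw [lintegral_cosRemainder_eq (by fun_prop) hσ (lintegral_sum_sq hY hind s),
      lintegral_cosRemainder_gaussianReal h']
    have := le_integral_cos_sum hY hind s hM (fun i _ => hv i) h t
    exact ENNReal.ofReal_le_ofReal (by linarith)

lemma rpow_add_mul_rpow_le {b x r : ℝ} (hb : 0 ≤ b) (hx : 0 ≤ x) (hr : 1 < r) :
    b ^ r + r * x * b ^ (r - 1) ≤ (b + x) ^ r := by
  rcases hb.eq_or_lt with rfl | hb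
  · rw [Real.zero_rpow (by linarith), Real.zero_rpow (by linarith)]
    simp only [mul_zero, zero_add]
    positivity
  · have h := one_add_mul_self_le_rpow_one_add (s := x / b) (by
      have : 0 ≤ x / b := by positivity
      linarith) hr.le
    rw [show b + x = b * (1 + x / b) by field_simp, Real.mul_rpow hb.le (by positivity),
      Real.rpow_sub_one hb.ne']
    calc b ^ r + r * x * (b ^ r / b) = b ^ r * (1 + r * (x / b)) := by ring
      _ ≤ _ := by gcongr

lemma rpow_add_le {b x r : ℝ} (hb : 0 ≤ b) (hx : 0 ≤ x) (hr : 1 < r) :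
    (b + x) ^ r ≤ b ^ r + r * x * (b + x) ^ (r - 1) := by
  rcases (add_nonneg hb hx).eq_or_lt with h0 | h0
  · rw [← h0, Real.zero_rpow (by linarith), Real.zero_rpow (by linarith)]
    simp only [mul_zero, add_zero]
    positivity
  · have h := one_add_mul_self_le_rpow_one_add (s := -(x / (b + x))) (by
      have : x / (b + x) ≤ 1 := (div_le_one h0).2 (by linarith)
      linarith) hr.le
    have he : b = (b + x) * (1 + -(x / (b + x))) := by field_simp; ring
    have h1 : 0 ≤ 1 + -(x / (b + x)) := by
      have : x / (b + x) ≤ 1 := (div_le_one h0).2 (by linarith)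
      linarith
    have h2 : b ^ r = (b + x) ^ r * (1 + -(x / (b + x))) ^ r := by
      conv_lhs => rw [he]
      rw [Real.mul_rpow h0.le h1]
    have h3 : (b + x) ^ r * (1 + r * -(x / (b + x))) ≤ b ^ r := by
      rw [h2]; gcongr
    rw [Real.rpow_sub_one h0.ne']
    calc (b + x) ^ r = (b + x) ^ r * (1 + r * -(x / (b + x)))
          + r * x * ((b + x) ^ r / (b + x)) := by ring
      _ ≤ _ := by gcongr

/-- Outer induction raises p by 2, inner induction adds a summand. The inner step combines order p
for the old sum with order p - 2 for the enlarged sum, and closes by Bernoulli's inequality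
`rpow_add_mul_rpow_le`. -/
lemma lintegral_abs_sum_rpow_le (hY : ∀ i, IsSymmNBU (Y i) P (v i))
    (hind : iIndepFun Y P) {M : ℝ} (hM : 0 ≤ M) (hv : ∀ i, v i ≤ M) (k : ℕ) :
    ∀ p : ℝ, 2 + 2 * k ≤ p → p < 4 + 2 * k → ∀ s : Finset ι,
    ∫⁻ ω, ENNReal.ofReal (|∑ i ∈ s, Y i ω| ^ p) ∂P
      ≤ ENNReal.ofReal (gaussianAbsMoment p * ((∑ i ∈ s, v i) + (1 + k) * M) ^ (p / 2)) := by
  classical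
  have hm : ∀ i, Measurable (Y i) := fun i => (hY i).meas
  induction k with
  | zero =>
    intro p hp hp' s
    simpa using lintegral_abs_sum_rpow_le_of_lt_four hY hind hM hv (by simpa using hp)
      (by simpa using hp') s
  | succ k ih =>
    intro p hp hp' s
    push_cast at hp hp' ⊢
    have hk : (0 : ℝ) ≤ k := Nat.cast_nonneg k
    have hp4 : 4 ≤ p := by linarith
    have hmp := gaussianAbsMoment_pos (by linarith : -1 < p)
    have hmp2 := gaussianAbsMoment_pos (by linarith : -1 < p - 2)
    induction s using Finset.induction_on with
    | empty => simp [Real.zero_rpow (by linarith : p ≠ 0)]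
    | insert i s hi ihs =>
      have hvi := (hY i).nonneg
      have hσ : 0 ≤ ∑ i ∈ s, v i := Finset.sum_nonneg fun i _ => (hY i).nonneg
      have h2 := ih (p - 2) (by linarith) (by linarith) (insert i s)
      simp only [Finset.sum_insert hi, add_comm (Y i _), add_comm (v i)] at h2 ⊢
      refine ((hY i).lintegral_indep_add_rpow_le (by fun_prop)
        (indepFun_sum_of_notMem hY hind hi) hp4).trans ?_
      refine (add_le_add ihs (mul_le_mul_right h2 _)).trans ?_
      have hpp : 0 ≤ p - 1 := by linarith
      rw [← ENNReal.ofReal_mul (by positivity), ← ENNReal.ofReal_add (by positivity)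
        (by positivity)]
      refine ENNReal.ofReal_le_ofReal ?_
      have hsc := rpow_add_mul_rpow_le (b := ∑ i ∈ s, v i + (1 + (k + 1)) * M) (by positivity) hvi
        (by linarith : 1 < p / 2)
      -- The additional M of the new level absorbs the new variance, since vᵢ ≤ M.
      have hmono : ((∑ i ∈ s, v i) + v i + (1 + k) * M) ^ (p / 2 - 1)
          ≤ (∑ i ∈ s, v i + (1 + (k + 1)) * M) ^ (p / 2 - 1) :=
        Real.rpow_le_rpow (by positivity) (by linarith [hv i]) (by linarith)
      calc _ = gaussianAbsMoment p * ((∑ i ∈ s, v i + (1 + (k + 1)) * M) ^ (p / 2)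
            + p / 2 * v i * ((∑ i ∈ s, v i) + v i + (1 + k) * M) ^ (p / 2 - 1)) := by
            rw [gaussianAbsMoment_eq_mul (by linarith : 1 < p),
              show (p - 2) / 2 = p / 2 - 1 by ring]
            ring
        _ ≤ gaussianAbsMoment p * (∑ i ∈ s, v i + (1 + (k + 1)) * M + v i) ^ (p / 2) := by
            gcongr
            exact le_trans (by gcongr) hsc
        _ = _ := by congr 2; ring

/-- Same double induction, but the lower recursion needs order p - 2 only for the old sum, and
`rpow_add_le` is the matching form of Bernoulli's inequality. -/
lemma le_lintegral_abs_sum_rpow (hY : ∀ i, IsSymmNBU (Y i) P (v i))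
    (hind : iIndepFun Y P) {M : ℝ} (hM : 0 ≤ M) (hv : ∀ i, v i ≤ M) (k : ℕ) :
    ∀ p : ℝ, 2 + 2 * k ≤ p → p < 4 + 2 * k → ∀ s : Finset ι,
    ENNReal.ofReal (gaussianAbsMoment p * (max 0 ((∑ i ∈ s, v i) - (4 + k) * M)) ^ (p / 2))
      ≤ ∫⁻ ω, ENNReal.ofReal (|∑ i ∈ s, Y i ω| ^ p) ∂P := by
  classical
  have hm : ∀ i, Measurable (Y i) := fun i => (hY i).meas
  induction k with
  | zero =>
    intro p hp hp' s
    simpa using le_lintegral_abs_sum_rpow_of_lt_four hY hind hM hv (by simpa using hp)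
      (by simpa using hp') s
  | succ k ih =>
    intro p hp hp' s
    push_cast at hp hp' ⊢
    have hk : (0 : ℝ) ≤ k := Nat.cast_nonneg k
    have hp4 : 4 ≤ p := by linarith
    have hmp := gaussianAbsMoment_pos (by linarith : -1 < p)
    have hmp2 := gaussianAbsMoment_pos (by linarith : -1 < p - 2)
    induction s using Finset.induction_on with
    | empty =>
      rw [max_eq_left (by simp; positivity), Real.zero_rpow (by linarith)]
      simp
    | insert i s hi ihs =>
      have hvi := (hY i).nonneg
      have h2 := ih (p - 2) (by linarith) (by linarith) s
      simp only [Finset.sum_insert hi, add_comm (Y i _), add_comm (v i)]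
      refine le_trans ?_ ((hY i).le_lintegral_indep_add_rpow (by fun_prop)
        (indepFun_sum_of_notMem hY hind hi) hp4)
      refine le_trans ?_ (add_le_add ihs (mul_le_mul_right h2 _))
      have hpp : 0 ≤ p - 1 := by linarith
      rw [← ENNReal.ofReal_mul (by positivity), ← ENNReal.ofReal_add (by positivity)
        (by positivity)]
      refine ENNReal.ofReal_le_ofReal ?_
      set B := max 0 (∑ i ∈ s, v i - (4 + (k + 1)) * M)
      set C := max 0 (∑ i ∈ s, v i + v i - (4 + (k + 1)) * M)
      set D := max 0 (∑ i ∈ s, v i - (4 + k) * M)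
      have hB : 0 ≤ B := le_max_left _ _
      have hBC : B ≤ C := max_le_max le_rfl (by linarith)
      have hCB : C - B ≤ v i := by
        have : C ≤ B + v i := max_le (by positivity) (by
          linarith [le_max_right 0 (∑ i ∈ s, v i - (4 + (k + 1)) * M)])
        linarith
      -- The extra M subtracted at the new level outweighs vᵢ; together with C - B ≤ vᵢ this
      -- survives truncation at 0.
      have hCD : C ≤ D := max_le_max le_rfl (by linarith [hv i])
      have hsc := rpow_add_le hB (sub_nonneg.2 hBC) (by linarith : 1 < p / 2)
      rw [add_sub_cancel] at hsc
      have hr : 0 ≤ p / 2 - 1 := by linarith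
      have hC : 0 ≤ C := hB.trans hBC
      calc gaussianAbsMoment p * C ^ (p / 2)
          ≤ gaussianAbsMoment p * (B ^ (p / 2) + p / 2 * v i * D ^ (p / 2 - 1)) := by
            gcongr
            exact hsc.trans (by gcongr)
        _ = _ := by
            rw [gaussianAbsMoment_eq_mul (by linarith : 1 < p),
              show (p - 2) / 2 = p / 2 - 1 by ring]
            ring

end Moments

/-! ### From moments to norms, and the conclusion. -/

lemma MeasureTheory.MemLp.ofReal_lpNorm_rpow {Ω : Type*} [MeasurableSpace Ω] {P : Measure Ω}
    {S : Ω → ℝ} {p : ℝ} (hp : 0 < p) (h : MemLp S (ENNReal.ofReal p) P) :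
    ENNReal.ofReal (lpNorm S (ENNReal.ofReal p) P ^ p) = ∫⁻ ω, ENNReal.ofReal (|S ω| ^ p) ∂P := by
  rw [← ENNReal.ofReal_rpow_of_nonneg lpNorm_nonneg hp.le, ofReal_lpNorm h,
    eLpNorm_eq_lintegral_rpow_enorm_toReal (by simpa using hp) ENNReal.ofReal_ne_top,
    ENNReal.toReal_ofReal hp.le, ← ENNReal.rpow_mul, one_div_mul_cancel hp.ne', ENNReal.rpow_one]
  simp only [Real.enorm_eq_ofReal_abs, ENNReal.ofReal_rpow_of_nonneg (abs_nonneg _) hp.le]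

lemma memLp_gaussianReal (p : ℝ) :
    MemLp (fun x : ℝ => x) (ENNReal.ofReal p) (gaussianReal 0 1) :=
  memLp_id_gaussianReal p.toNNReal

lemma gaussianNorm_rpow {p : ℝ} (hp : 0 < p) : gaussianNorm p ^ p = gaussianAbsMoment p := by
  have h := (memLp_gaussianReal p).ofReal_lpNorm_rpow hp
  rw [lintegral_abs_rpow_gaussianReal (by linarith), ENNReal.ofReal_eq_ofReal_iff
    (Real.rpow_nonneg lpNorm_nonneg _) (gaussianAbsMoment_pos (by linarith)).le] at h
  exact h

lemma gaussianNorm_pos {p : ℝ} (hp : 0 < p) : 0 < gaussianNorm p := by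
  refine lt_of_le_of_ne lpNorm_nonneg fun h => ?_
  have h1 := gaussianNorm_rpow hp
  rw [← h, Real.zero_rpow hp.ne'] at h1
  exact (gaussianAbsMoment_pos (by linarith)).ne h1

/-- γ_p^p = (p-1) γ_{p-2}^(p-2) ≤ (p-1) γ_p^(p-2), since norms on a probability space increase with
the exponent. -/
lemma gaussianNorm_sq_le {p : ℝ} (hp : 2 < p) : gaussianNorm p ^ 2 ≤ p - 1 := by
  have hpos := gaussianNorm_pos (by linarith : 0 < p)
  have hmono : gaussianNorm (p - 2) ≤ gaussianNorm p := by
    unfold gaussianNorm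
    rw [← ENNReal.ofReal_le_ofReal_iff lpNorm_nonneg, ofReal_lpNorm (memLp_gaussianReal _),
      ofReal_lpNorm (memLp_gaussianReal _)]
    exact eLpNorm_le_eLpNorm_of_exponent_le (ENNReal.ofReal_le_ofReal (by linarith))
      (memLp_gaussianReal 1).1
  have h1 : gaussianNorm p ^ p ≤ (p - 1) * gaussianNorm p ^ (p - 2) := by
    rw [gaussianNorm_rpow (by linarith), gaussianAbsMoment_eq_mul (by linarith),
      ← gaussianNorm_rpow (by linarith : 0 < p - 2)]
    have : 0 ≤ p - 1 := by linarith
    have := (gaussianNorm_pos (by linarith : 0 < p - 2)).le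
    gcongr
  have h2 : gaussianNorm p ^ p = gaussianNorm p ^ 2 * gaussianNorm p ^ (p - 2) := by
    rw [← Real.rpow_two, ← Real.rpow_add hpos]; congr 1; ring
  rw [h2] at h1
  exact le_of_mul_le_mul_right h1 (by positivity)

lemma Real.sqrt_add_le_sqrt_add_sqrt {x y : ℝ} (hx : 0 ≤ x) (hy : 0 ≤ y) :
    √(x + y) ≤ √x + √y := by
  rw [Real.sqrt_le_left (by positivity), add_sq, Real.sq_sqrt hx, Real.sq_sqrt hy]
  have : 0 ≤ √x * √y := by positivity
  linarith

theorem corollary3 {Ω : Type*} [MeasurableSpace Ω] (P : Measure Ω) [IsProbabilityMeasure P]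
    (n : ℕ) (X : Fin n → Ω → ℝ) (a : Fin n → ℝ) (p : ℝ)
    (hmeas : ∀ i, Measurable (X i))
    (hindep : iIndepFun X P)
    (hsymm : ∀ i, IsSymmetricRV (X i) P)
    (htail : ∀ i, HasLogConcaveTails (X i) P)
    (hvar : ∀ i, ∫ ω, (X i ω) ^ 2 ∂P = 1)
    (hp : 3 ≤ p) :
    MemLp (fun ω => ∑ i, a i * X i ω) (ENNReal.ofReal p) P ∧
      |lpNorm (fun ω => ∑ i, a i * X i ω) (ENNReal.ofReal p) P
          - gaussianNorm p * √(∑ i, a i ^ 2)|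
        ≤ p * ⨆ i, |a i| := by
  have hp0 : 0 < p := by linarith
  have hY : ∀ i, IsSymmNBU (fun ω => a i * X i ω) P (a i ^ 2) := fun i =>
    isSymmNBU_const_mul (hmeas i) (hsymm i) (htail i) (hvar i) (a i)
  have hind : iIndepFun (fun i ω => a i * X i ω) P :=
    hindep.comp (fun i x => a i * x) fun i => measurable_const_mul (a i)
  have hmem : MemLp (fun ω => ∑ i, a i * X i ω) (ENNReal.ofReal p) P :=
    memLp_finsetSum _ fun i _ => (hY i).memLp hp0
  refine ⟨hmem, ?_⟩
  set m := ⨆ i, |a i|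
  have hm : 0 ≤ m := Real.iSup_nonneg fun i => abs_nonneg _
  have hv : ∀ i, a i ^ 2 ≤ m ^ 2 := fun i => by
    rw [← sq_abs]
    have : |a i| ≤ m := le_ciSup (Set.finite_range fun i => |a i|).bddAbove i
    gcongr
  set σ₂ := ∑ i, a i ^ 2
  have hσ : 0 ≤ σ₂ := Finset.sum_nonneg fun i _ => sq_nonneg _
  set N := lpNorm (fun ω => ∑ i, a i * X i ω) (ENNReal.ofReal p) P
  have hN : 0 ≤ N := lpNorm_nonneg
  have hγ := gaussianNorm_pos hp0
  have hNp := hmem.ofReal_lpNorm_rpow hp0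
  -- The number of steps of length 2 that bring p down into [2, 4).
  set k := ⌊(p - 2) / 2⌋₊
  have hk1 : (k : ℝ) ≤ (p - 2) / 2 := Nat.floor_le (by linarith)
  have hk2 : (p - 2) / 2 < k + 1 := Nat.lt_floor_add_one _
  have hroot : ∀ {w : ℝ}, 0 ≤ w →
      gaussianAbsMoment p * w ^ (p / 2) = (gaussianNorm p * √w) ^ p := by
    intro w hw
    rw [Real.mul_rpow hγ.le (Real.sqrt_nonneg _), gaussianNorm_rpow hp0, Real.sqrt_eq_rpow,
      ← Real.rpow_mul hw]
    congr 2; ring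
  have hup := lintegral_abs_sum_rpow_le hY hind (sq_nonneg m) hv k p (by linarith) (by linarith)
    Finset.univ
  have hlow := le_lintegral_abs_sum_rpow hY hind (sq_nonneg m) hv k p (by linarith) (by linarith)
    Finset.univ
  have hw : 0 ≤ σ₂ + (1 + k) * m ^ 2 := by positivity
  rw [← hNp, hroot hw, ENNReal.ofReal_le_ofReal_iff (by positivity),
    Real.rpow_le_rpow_iff hN (by positivity) hp0] at hup
  rw [← hNp, hroot (le_max_left _ _), ENNReal.ofReal_le_ofReal_iff (by positivity),
    Real.rpow_le_rpow_iff (by positivity) hN hp0] at hlow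
  -- After bounding k by (p-2)/2, the inequality is (p-2)(p-3) ≥ 0: here p ≥ 3 is needed.
  have hconst : gaussianNorm p * √(4 + k) ≤ p := by
    refine abs_le_of_sq_le_sq' ?_ hp0.le |>.2
    rw [mul_pow, Real.sq_sqrt (by positivity)]
    have h1 := gaussianNorm_sq_le (by linarith : 2 < p)
    calc gaussianNorm p ^ 2 * (4 + k) ≤ (p - 1) * (4 + (p - 2) / 2) := by gcongr; linarith
      _ ≤ p ^ 2 := by nlinarith
  have hsqrt : √((4 + k) * m ^ 2) = √(4 + k) * m := by
    rw [Real.sqrt_mul (by positivity), Real.sqrt_sq hm]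
  have hcm : gaussianNorm p * (√(4 + k) * m) ≤ p * m := by
    rw [← mul_assoc]; gcongr
  rw [abs_le]
  constructor
  · have h1 : √σ₂ ≤ √(max 0 (σ₂ - (4 + k) * m ^ 2)) + √(4 + k) * m := by
      rw [← hsqrt]
      refine (Real.sqrt_le_sqrt ?_).trans (Real.sqrt_add_le_sqrt_add_sqrt (by positivity) (by positivity))
      linarith [le_max_right 0 (σ₂ - (4 + k) * m ^ 2)]
    have h2 := mul_le_mul_of_nonneg_left h1 hγ.le
    linarith
  · have h1 : √(σ₂ + (1 + k) * m ^ 2) ≤ √σ₂ + √(4 + k) * m := by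
      rw [← hsqrt]
      refine (Real.sqrt_le_sqrt ?_).trans (Real.sqrt_add_le_sqrt_add_sqrt (by positivity) (by positivity))
      nlinarith [sq_nonneg m]
    have h2 := mul_le_mul_of_nonneg_left h1 hγ.le
    linarith
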